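/- A cycle in a finite simple graph $G$ is a subgraph of $G$ (not necessarily induced) that is isomorphic to the cycle $C_m$ on $m$ vertices for some $m\ge 3$; let $c(G)$ denote the number of cycles in $G$. There exists a positive integer $n_0$ such that for every $n\ge n_0$ the balanced complete bipartite graph $K_{\lfloor n/2\rfloor,\lceil n/2\rceil}$ is, up to isomorphism, the unique triangle-free graph on $n$ vertices with the largest number of cycles: it is triangle-free, and every triangle-free graph $G$ on $n$ vertices that is not isomorphic to $K_{\lfloor n/2\rfloor,\lceil n/2\rceil}$ satisfies $c(G)<c(K_{\lfloor n/2\rfloor,\lceil n/2\rceil})$. -/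

import Mathlib

/-- A subgraph `H` of `G` is a cycle of `G` if it is isomorphic, as a graph on its own vertices,
to the cycle `C_m` on `m` vertices for some `m ≥ 3`. -/
def IsCycleSubgraph {V : Type*} {G : SimpleGraph V} (H : G.Subgraph) : Prop :=
  ∃ m : ℕ, 3 ≤ m ∧ Nonempty (SimpleGraph.cycleGraph m ≃g H.coe)

/-- The number `c(G)` of cycles in a finite graph `G`: the number of its subgraphs that are cycles,
so that a cycle has neither a starting point nor a direction. -/
noncomputable def cycleCount {V : Type*} [Finite V] (G : SimpleGraph V) : ℕ :=
  Set.ncard {H : G.Subgraph | IsCycleSubgraph H}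

/-- The balanced complete bipartite graph on `n` vertices, with parts of sizes `⌊n/2⌋`
and `⌈n/2⌉`. -/
abbrev balancedCompleteBipartite (n : ℕ) : SimpleGraph (Fin (n / 2) ⊕ Fin ((n + 1) / 2)) :=
  completeBipartiteGraph (Fin (n / 2)) (Fin ((n + 1) / 2))

/-! Bipartite and non-bipartite graphs are treated separately.

Bipartite case. A copy of a cycle in a 2-coloured graph consists of a 2-colouring of the cycle and a
colour-respecting injection of its vertices. A cycle has equally many vertices of each colour, so
with colour classes of sizes `a`, `b` there are at most `a.descFactorial p * b.descFactorial p`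
injections per colouring, with equality when all bichromatic pairs are edges. This product is
largest for balanced classes (`descFactorial_mul_le`). Hence the balanced graph is optimal for every
cycle length separately. For 4-cycles the inequality is strict if the classes are unbalanced or a
bichromatic pair is not an edge (`descFactorial_two_mul_lt`, `card_copy_four_lt`).

Non-bipartite case. By the Andrásfai–Erdős–Sós theorem some vertex `v` has degree `d ≤ 2n/5`. A
cycle through `v` is determined by its two neighbours of `v` and the path joining them in the rest.
In a triangle-free graph two consecutive steps of a path have at most `d' * (r - d')` choices among
`r` unused vertices, which bounds the number of paths by `pathBound` (`pathCount_le_pathBound`), of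
order a constant times `⌊r/2⌋! * ⌈r/2⌉!`. Cycles avoiding `v` are bounded crudely by deleting the
other vertices one at a time (`cycleBound_le`); they are of lower order. The factor `(2/5)²` then
puts the total below the number of longest even cycles of the balanced graph (`le_cycleCount_even`,
`le_cycleCount_odd`). In the odd case the margin is thin, which forces the sharpened value
`pathBound 4 = 9`. -/

open SimpleGraph

/-! ### Cycle subgraphs and copies of cycle graphs. -/

/-- A copy of `H` in `G` is the same as a subgraph `G'` of `G` with an isomorphism `H ≃g G'`. -/
theorem copy_of_iso_bijective {V W : Type*} (G : SimpleGraph V) (H : SimpleGraph W) :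
    Function.Bijective (fun x : (Σ G' : {G' : G.Subgraph // Nonempty (H ≃g G'.coe)},
      (H ≃g G'.1.coe)) => x.1.1.coeCopy.comp x.2.toCopy) := by
  have key : ∀ (G' : G.Subgraph) (e : H ≃g G'.coe),
      (G'.coeCopy.comp e.toCopy).toSubgraph = G' := by
    intro G' e
    ext a b
    · simp only [Subgraph.map_verts, Subgraph.verts_top, Set.image_univ, Set.mem_range]
      constructor
      · rintro ⟨x, rfl⟩
        exact (e x).2
      · intro h
        exact ⟨e.symm ⟨a, h⟩, by simp [Subgraph.coeCopy]⟩
    · simp only [Subgraph.map_adj, Relation.Map, Subgraph.top_adj]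
      constructor
      · rintro ⟨x, y, h, rfl, rfl⟩
        exact e.map_adj_iff.2 h
      · intro h
        refine ⟨e.symm ⟨a, G'.edge_vert h⟩, e.symm ⟨b, G'.edge_vert h.symm⟩, ?_, ?_, ?_⟩
        · exact e.symm.map_adj_iff.2 (by simpa using h)
        · simp [Subgraph.coeCopy]
        · simp [Subgraph.coeCopy]
  constructor
  · rintro ⟨⟨G₁, h₁⟩, e₁⟩ ⟨⟨G₂, h₂⟩, e₂⟩ h
    dsimp only at h
    have : G₁ = G₂ := by rw [← key G₁ e₁, h, key]
    subst this
    congr 1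
    ext x
    exact congrArg (fun c : Copy H G => c x) h
  · intro f
    refine ⟨⟨⟨f.toSubgraph, ⟨f.isoToSubgraph⟩⟩, f.isoToSubgraph⟩, ?_⟩
    ext x
    rfl

/-- All isomorphisms from `H` onto a fixed subgraph form a torsor under the automorphisms of `H`.
The automorphism factor cancels when two host graphs are compared. -/
theorem card_copy_eq {V W : Type*} [Finite V] [Finite W] (G : SimpleGraph V)
    (H : SimpleGraph W) :
    Nat.card (Copy H G) =
      {G' : G.Subgraph | Nonempty (H ≃g G'.coe)}.ncard * Nat.card (H ≃g H) := by
  classical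
  have : Fintype V := Fintype.ofFinite V
  have : Fintype W := Fintype.ofFinite W
  have hfin : Finite {G' : G.Subgraph // Nonempty (H ≃g G'.coe)} := inferInstance
  have : Fintype {G' : G.Subgraph // Nonempty (H ≃g G'.coe)} := Fintype.ofFinite _
  have hiso : ∀ G' : {G' : G.Subgraph // Nonempty (H ≃g G'.coe)}, Finite (H ≃g G'.1.coe) :=
    fun G' => Finite.of_injective (fun e : H ≃g G'.1.coe => (e : W → G'.1.verts))
      DFunLike.coe_injective
  rw [← Nat.card_congr (Equiv.ofBijective _ (copy_of_iso_bijective G H)), Nat.card_sigma]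
  have : ∀ G' : {G' : G.Subgraph // Nonempty (H ≃g G'.coe)},
      Nat.card (H ≃g G'.1.coe) = Nat.card (H ≃g H) := by
    rintro ⟨G', ⟨e⟩⟩
    exact Nat.card_congr ⟨fun g => g.trans e.symm, fun g => g.trans e,
      fun g => by ext; simp, fun g => by ext; simp⟩
  simp_rw [this]
  rw [Finset.sum_const, smul_eq_mul, Finset.card_univ, ← Nat.card_eq_fintype_card,
    ← Nat.card_coe_set_eq]
  rfl

/-- The number of cycles of length `m`. -/
noncomputable def cycleCountOfLength {V : Type*} [Finite V] (G : SimpleGraph V) (m : ℕ) : ℕ :=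
  {H : G.Subgraph | Nonempty (cycleGraph m ≃g H.coe)}.ncard

theorem card_verts_of_iso {V : Type*} {G : SimpleGraph V} {H : G.Subgraph} {m : ℕ}
    (e : cycleGraph m ≃g H.coe) : H.verts.ncard = m := by
  rw [← Nat.card_coe_set_eq, ← Nat.card_congr e.toEquiv, Nat.card_fin]

theorem cycleCount_eq_sum {V : Type*} [Finite V] (G : SimpleGraph V) (n : ℕ)
    (hn : Nat.card V = n) :
    cycleCount G = ∑ m ∈ Finset.Icc 3 n, cycleCountOfLength G m := by
  classical
  have : Fintype G.Subgraph := Fintype.ofFinite _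
  rw [cycleCount, Set.ncard_eq_toFinset_card',
    Finset.card_eq_sum_card_fiberwise (f := fun H => H.verts.ncard) (t := Finset.Icc 3 n)]
  · refine Finset.sum_congr rfl fun m hm => ?_
    rw [cycleCountOfLength, Set.ncard_eq_toFinset_card']
    congr 1
    ext H
    simp only [Finset.mem_filter, Set.mem_toFinset, Set.mem_ofPred_eq]
    constructor
    · rintro ⟨⟨k, hk, ⟨e⟩⟩, h⟩
      rw [card_verts_of_iso e] at h
      exact h ▸ ⟨e⟩
    · rintro ⟨e⟩
      exact ⟨⟨m, (Finset.mem_Icc.1 hm).1, ⟨e⟩⟩, card_verts_of_iso e⟩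
  · intro H hH
    simp only [Finset.mem_coe, Set.mem_toFinset, Set.mem_ofPred_eq] at hH
    obtain ⟨m, hm, ⟨e⟩⟩ := hH
    rw [Finset.coe_Icc, Set.mem_Icc]
    refine ⟨hm.trans (card_verts_of_iso e).ge, ?_⟩
    rw [← hn]
    exact Set.ncard_le_card _

theorem card_copy_cycleGraph {V : Type*} [Finite V] (G : SimpleGraph V) (m : ℕ) :
    Nat.card (Copy (cycleGraph m) G) =
      cycleCountOfLength G m * Nat.card (cycleGraph m ≃g cycleGraph m) :=
  card_copy_eq G (cycleGraph m)

theorem card_aut_cycleGraph_pos (m : ℕ) : 0 < Nat.card (cycleGraph m ≃g cycleGraph m) := by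
  have : Finite (cycleGraph m ≃g cycleGraph m) :=
    Finite.of_injective (fun e => (e : Fin m → Fin m)) DFunLike.coe_injective
  have : Nonempty (cycleGraph m ≃g cycleGraph m) := ⟨Iso.refl⟩
  exact Nat.card_pos

/-- An automorphism is determined by the image of `0` and by its direction there, since `e (i + 2)`
is the neighbour of `e (i + 1)` other than `e i`. Only this half of the dihedral count is needed,
for lower bounds on cycle numbers. -/
theorem card_aut_cycleGraph_le (m : ℕ) :
    Nat.card (cycleGraph (m + 3) ≃g cycleGraph (m + 3)) ≤ 2 * (m + 3) := by
  have hne : ∀ i : Fin (m + 3), i + 1 + 1 ≠ i := by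
    intro i h
    rw [add_assoc] at h
    have : (1 + 1 : Fin (m + 3)) = 0 := by simpa using h
    exact absurd this (ne_of_beq_false rfl)
  have hadj : ∀ i : Fin (m + 3), (cycleGraph (m + 3)).Adj i (i + 1) := by
    intro i
    rw [cycleGraph_adj]
    right
    simp
  have hinj : Function.Injective (fun e : cycleGraph (m + 3) ≃g cycleGraph (m + 3) =>
      (e 0, decide (e 1 = e 0 + 1))) := by
    intro e e' h
    simp only [Prod.mk.injEq, decide_eq_decide] at h
    obtain ⟨h0, h1⟩ := h
    have step : ∀ (f : cycleGraph (m + 3) ≃g cycleGraph (m + 3)) (i : Fin (m + 3)),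
        f (i + 1) = f i + 1 ∨ f (i + 1) = f i - 1 := by
      intro f i
      have := f.map_adj_iff.2 (hadj i)
      rw [cycleGraph_adj] at this
      rcases this with h | h
      · right; exact eq_sub_of_add_eq' (sub_eq_iff_eq_add.1 h).symm
      · left; rw [sub_eq_iff_eq_add'.1 h]
    have h1' : e 1 = e' 1 := by
      have a := step e 0
      have b := step e' 0
      rw [zero_add] at a b
      by_cases h : e 1 = e 0 + 1
      · rw [h, h1.1 h, h0]
      · have h' : ¬ e' 1 = e' 0 + 1 := fun hh => h (h1.2 hh)
        rw [a.resolve_left h, b.resolve_left h', h0]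
    have two : ∀ (i : Fin (m + 3)) (f : cycleGraph (m + 3) ≃g cycleGraph (m + 3)),
        f (i + 1 + 1) = f (i + 1) + (f (i + 1) - f i) := by
      intro i f
      have hn : f (i + 1 + 1) ≠ f i := fun h => hne i (f.injective h)
      rcases step f i with a | a <;> rcases step f (i + 1) with b | b
      · rw [b, a]; abel
      · exact absurd (by rw [b, a]; abel) hn
      · exact absurd (by rw [b, a]; abel) hn
      · rw [b, a]; abel
    have all : ∀ i : Fin (m + 2 + 1), e i = e' i ∧ e (i + 1) = e' (i + 1) := by
      intro i
      induction i using Fin.induction with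
      | zero => rw [zero_add]; exact ⟨h0, h1'⟩
      | succ k ih =>
        rw [← Fin.coeSucc_eq_succ]
        refine ⟨ih.2, ?_⟩
        rw [two, two, ih.1, ih.2]
    exact RelIso.ext fun i => (all i).1
  calc Nat.card (cycleGraph (m + 3) ≃g cycleGraph (m + 3))
      ≤ Nat.card (Fin (m + 3) × Bool) := Nat.card_le_card_of_injective _ hinj
    _ = 2 * (m + 3) := by simp [mul_comm]

/-! ### Cycles in 2-coloured graphs. -/

theorem card_embedding_with_pattern {ι V : Type*} [Fintype ι] [Fintype V] (c : V → Bool)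
    (s : ι → Bool) :
    Nat.card {f : ι ↪ V // ∀ i, c (f i) = s i} =
      (Nat.card {v // c v = true}).descFactorial (Nat.card {i // s i = true}) *
      (Nat.card {v // c v = false}).descFactorial (Nat.card {i // s i = false}) := by
  classical
  let e : {f : ι ↪ V // ∀ i, c (f i) = s i} ≃
      ({i // s i = true} ↪ {v // c v = true}) × ({i // s i = false} ↪ {v // c v = false}) :=
    { toFun := fun f =>
        (⟨fun i => ⟨f.1 i, by rw [f.2]; exact i.2⟩,
          fun i j h => Subtype.ext (f.1.injective (congrArg Subtype.val h))⟩,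
         ⟨fun i => ⟨f.1 i, by rw [f.2]; exact i.2⟩,
          fun i j h => Subtype.ext (f.1.injective (congrArg Subtype.val h))⟩)
      invFun := fun g =>
        ⟨⟨fun i => if h : s i = true then (g.1 ⟨i, h⟩).1 else
            (g.2 ⟨i, Bool.eq_false_of_not_eq_true h⟩).1, by
          intro i j hij
          dsimp only at hij
          split_ifs at hij with hi hj hj
          · exact congrArg Subtype.val (g.1.injective (Subtype.ext hij))
          · have h1 := (g.1 ⟨i, hi⟩).2
            rw [hij, (g.2 _).2] at h1
            exact absurd h1 (by decide)
          · have h1 := (g.1 ⟨j, hj⟩).2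
            rw [← hij, (g.2 _).2] at h1
            exact absurd h1 (by decide)
          · exact congrArg Subtype.val (g.2.injective (Subtype.ext hij))⟩, by
          intro i
          change c (dite (s i = true) _ _) = s i
          split_ifs with h
          · rw [(g.1 _).2, h]
          · rw [(g.2 _).2, Bool.eq_false_of_not_eq_true h]⟩
      left_inv := by
        rintro ⟨f, hf⟩
        ext i
        change dite (s i = true) _ _ = f i
        split_ifs <;> rfl
      right_inv := by
        rintro ⟨g₁, g₂⟩
        ext ⟨i, hi⟩
        · simp [hi]
        · simp [hi] }
  rw [Nat.card_congr e, Nat.card_prod]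
  simp [Nat.card_eq_fintype_card, Fintype.card_embedding_eq]

/-- The function sending a copy of `H` in a 2-coloured graph to the induced colouring of `H`
together with the underlying injection. -/
def copyToPattern {W V : Type*} {H : SimpleGraph W} {G : SimpleGraph V} (col : G.Coloring Bool)
    (f : Copy H G) : Σ s : H.Coloring Bool, {g : W ↪ V // ∀ i, col (g i) = s i} :=
  ⟨col.comp f.toHom, f.toEmbedding, fun _ => rfl⟩

theorem copyToPattern_injective {W V : Type*} {H : SimpleGraph W} {G : SimpleGraph V}
    (col : G.Coloring Bool) : Function.Injective (copyToPattern (H := H) col) := by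
  intro f g h
  ext i
  exact congrArg (fun x : (Σ s : H.Coloring Bool, {g : W ↪ V // ∀ i, col (g i) = s i}) =>
    x.2.1 i) h

theorem copyToPattern_surjective {W V : Type*} {H : SimpleGraph W} {G : SimpleGraph V}
    (col : G.Coloring Bool) (hG : ∀ u v, col u ≠ col v → G.Adj u v) :
    Function.Surjective (copyToPattern (H := H) col) := by
  rintro ⟨s, g, hg⟩
  have hadj : ∀ i j, H.Adj i j → G.Adj (g i) (g j) := fun i j hij =>
    hG _ _ (by rw [hg, hg]; exact s.valid hij)
  obtain rfl : s = col.comp ⟨g, fun {i j} => hadj i j⟩ := by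
    ext i
    exact (hg i).symm
  exact ⟨⟨⟨g, fun {i j} => hadj i j⟩, g.injective⟩, rfl⟩

/-- The shift by one exchanges the two colours. For odd cycles there is no colouring, so no parity
hypothesis is needed. -/
theorem card_bool_fibers_cycleGraph (m : ℕ) (s : (cycleGraph (m + 3)).Coloring Bool) :
    Nat.card {i // s i = true} = Nat.card {i // s i = false} := by
  refine Nat.card_congr (Equiv.subtypeEquiv (Equiv.addRight 1) fun i => ?_)
  have h : (cycleGraph (m + 3)).Adj i (i + 1) := by
    rw [cycleGraph_adj]
    right
    simp
  have := s.valid h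
  rw [Equiv.coe_addRight]
  revert this
  cases s i <;> cases s (i + 1) <;> simp

theorem card_bool_fibers_add {ι : Type*} [Fintype ι] (s : ι → Bool) :
    Nat.card {i // s i = true} + Nat.card {i // s i = false} = Fintype.card ι := by
  classical
  have := Fintype.card_subtype_compl (fun i => s i = true)
  simp only [Bool.not_eq_true] at this
  rw [Nat.card_eq_fintype_card, Nat.card_eq_fintype_card, this]
  have := Fintype.card_subtype_le (fun i => s i = true)
  omega

instance coloringFinite {W : Type*} [Finite W] (H : SimpleGraph W) : Finite (H.Coloring Bool) :=
  Finite.of_injective (fun s => (s : W → Bool)) DFunLike.coe_injective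

noncomputable instance coloringFintype {W : Type*} [Finite W] (H : SimpleGraph W) :
    Fintype (H.Coloring Bool) := Fintype.ofFinite _

theorem card_patterns {V : Type*} [Fintype V] (c : V → Bool) (m : ℕ) :
    Nat.card (Σ s : (cycleGraph (m + 3)).Coloring Bool,
        {g : Fin (m + 3) ↪ V // ∀ i, c (g i) = s i}) =
      ∑ s : (cycleGraph (m + 3)).Coloring Bool,
        (Nat.card {v // c v = true}).descFactorial (Nat.card {i // s i = true}) *
        (Nat.card {v // c v = false}).descFactorial (Nat.card {i // s i = true}) := by
  rw [Nat.card_sigma]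
  refine Finset.sum_congr rfl fun s _ => ?_
  rw [card_embedding_with_pattern, card_bool_fibers_cycleGraph]

theorem card_copy_cycleGraph_le {V : Type*} [Fintype V] {G : SimpleGraph V}
    (col : G.Coloring Bool) (m : ℕ) :
    Nat.card (Copy (cycleGraph (m + 3)) G) ≤
      ∑ s : (cycleGraph (m + 3)).Coloring Bool,
        (Nat.card {v // col v = true}).descFactorial (Nat.card {i // s i = true}) *
        (Nat.card {v // col v = false}).descFactorial (Nat.card {i // s i = true}) := by
  rw [← card_patterns]
  exact Nat.card_le_card_of_injective _ (copyToPattern_injective col)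

theorem card_copy_cycleGraph_eq {V : Type*} [Fintype V] {G : SimpleGraph V}
    (col : G.Coloring Bool) (hG : ∀ u v, col u ≠ col v → G.Adj u v) (m : ℕ) :
    Nat.card (Copy (cycleGraph (m + 3)) G) =
      ∑ s : (cycleGraph (m + 3)).Coloring Bool,
        (Nat.card {v // col v = true}).descFactorial (Nat.card {i // s i = true}) *
        (Nat.card {v // col v = false}).descFactorial (Nat.card {i // s i = true}) := by
  rw [← card_patterns]
  exact Nat.card_congr (Equiv.ofBijective _
    ⟨copyToPattern_injective col, copyToPattern_surjective col hG⟩)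

theorem exists_ne_of_two_le_card {V : Type*} [Fintype V] {p : V → Prop}
    (h : 2 ≤ Nat.card {v // p v}) (u : V) : ∃ v, p v ∧ v ≠ u := by
  classical
  by_contra! hcon
  have : Subsingleton {v // p v} :=
    ⟨fun a b => Subtype.ext ((hcon a a.2).trans (hcon b b.2).symm)⟩
  have := Finite.card_le_one_iff_subsingleton (α := {v // p v}) |>.2 this
  omega

theorem card_copy_four_lt {V : Type*} [Fintype V] {G : SimpleGraph V}
    (col : G.Coloring Bool) (ht : 2 ≤ Nat.card {v // col v = true})
    (hf : 2 ≤ Nat.card {v // col v = false}) {x y : V} (hxy : col x ≠ col y)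
    (hadj : ¬ G.Adj x y) :
    Nat.card (Copy (cycleGraph (1 + 3)) G) <
      ∑ s : (cycleGraph (1 + 3)).Coloring Bool,
        (Nat.card {v // col v = true}).descFactorial (Nat.card {i // s i = true}) *
        (Nat.card {v // col v = false}).descFactorial (Nat.card {i // s i = true}) := by
  classical
  rw [← card_patterns]
  have : Finite (Copy (cycleGraph (1 + 3)) G) :=
    Finite.of_injective (fun f => (f : Fin 4 → V)) DFunLike.coe_injective
  have : Fintype (Copy (cycleGraph (1 + 3)) G) := Fintype.ofFinite _
  rw [Nat.card_eq_fintype_card, Nat.card_eq_fintype_card]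
  refine Fintype.card_lt_of_injective_not_surjective _ (copyToPattern_injective col) fun hs => ?_
  have hc : ∀ b, 2 ≤ Nat.card {v // col v = b} := by
    intro b; cases b <;> assumption
  obtain ⟨x', hx', hxx'⟩ := exists_ne_of_two_le_card (hc (col x)) x
  obtain ⟨y', hy', hyy'⟩ := exists_ne_of_two_le_card (hc (col y)) y
  have n1 : x ≠ y := fun h => hxy (h ▸ rfl)
  have n2 : x ≠ y' := fun h => hxy (h ▸ hy')
  have n3 : x' ≠ y := fun h => hxy (h ▸ hx'.symm)
  have n4 : x' ≠ y' := fun h => hxy (by rw [← hx', h, hy'])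
  -- This colour pattern is a 4-cycle through the missing edge `x y`, so no copy in `G` produces it.
  let g : Fin 4 → V := ![x, y, x', y']
  have hg : Function.Injective g := by
    intro i j
    fin_cases i <;> fin_cases j <;> simp [g, n1, n2, n3, n4, n1.symm, n2.symm, n3.symm, n4.symm,
      hxx', hyy', hxx'.symm, hyy'.symm]
  have hv : ∀ i j, (cycleGraph 4).Adj i j → col (g i) ≠ col (g j) := by
    intro i j
    have h1 : ¬ (cycleGraph 4).Adj 0 2 := by decide
    have h2 : ¬ (cycleGraph 4).Adj 2 0 := by decide
    have h3 : ¬ (cycleGraph 4).Adj 1 3 := by decide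
    have h4 : ¬ (cycleGraph 4).Adj 3 1 := by decide
    fin_cases i <;> fin_cases j <;>
      simp [g, h1, h2, h3, h4, hx', hy', hxy, hxy.symm]
  obtain ⟨f, hf⟩ := hs ⟨Coloring.mk (fun i => col (g i)) (fun {i j} h => hv i j h), ⟨g, hg⟩,
    fun _ => rfl⟩
  have hfg : ∀ i, f i = g i := fun i =>
    congrArg (fun x : (Σ s : (cycleGraph (1 + 3)).Coloring Bool,
      {g : Fin (1 + 3) ↪ V // ∀ i, col (g i) = s i}) => x.2.1 i) hf
  have h01 : (cycleGraph (1 + 3)).Adj 0 1 := by decide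
  have := f.toHom.map_adj h01
  simp only [Copy.toHom_apply, hfg] at this
  exact hadj this

/-! ### Optimal sizes of the colour classes. -/

theorem descFactorial_mul_le {a b α β : ℕ} (h : a + b = α + β) (h1 : α ≤ β) (h2 : β ≤ α + 1)
    (p : ℕ) :
    a.descFactorial p * b.descFactorial p ≤ α.descFactorial p * β.descFactorial p := by
  induction p with
  | zero => simp
  | succ p ih =>
    simp only [Nat.descFactorial_succ]
    -- The products are compared factor by factor: `a - p` and `b - p` have a fixed sum and their
    -- product is largest when they are balanced. If a truncated difference vanishes, the left side
    -- is zero.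
    have : (a - p) * (b - p) ≤ (α - p) * (β - p) := by
      rcases le_or_gt a p with ha | ha
      · simp [Nat.sub_eq_zero_of_le ha]
      rcases le_or_gt b p with hb | hb
      · simp [Nat.sub_eq_zero_of_le hb]
      have hα : p ≤ α := by omega
      obtain ⟨a, rfl⟩ := Nat.exists_eq_add_of_lt ha
      obtain ⟨b, rfl⟩ := Nat.exists_eq_add_of_lt hb
      obtain ⟨α, rfl⟩ := Nat.exists_eq_add_of_le hα
      obtain ⟨β, rfl⟩ := Nat.exists_eq_add_of_le (hα.trans h1)
      have e1 : p + a + 1 - p = a + 1 := by omega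
      have e2 : p + b + 1 - p = b + 1 := by omega
      rw [e1, e2, Nat.add_sub_cancel_left, Nat.add_sub_cancel_left]
      have hh : a + 1 + (b + 1) = α + β := by omega
      have : β = α ∨ β = α + 1 := by omega
      rcases this with rfl | rfl
      · zify at hh ⊢; nlinarith [sq_nonneg ((a : ℤ) - b)]
      · rcases lt_trichotomy a b with hab | hab | hab
        · zify at hh hab ⊢; nlinarith
        · omega
        · zify at hh hab ⊢; nlinarith
    calc (a - p) * a.descFactorial p * ((b - p) * b.descFactorial p)
        = ((a - p) * (b - p)) * (a.descFactorial p * b.descFactorial p) := by ring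
      _ ≤ ((α - p) * (β - p)) * (α.descFactorial p * β.descFactorial p) :=
          Nat.mul_le_mul this ih
      _ = _ := by ring

theorem descFactorial_two_mul_lt {a b α β : ℕ} (h : a + b = α + β) (h1 : α ≤ β)
    (h2 : β ≤ α + 1) (hα : 2 ≤ α) (ha : a ≠ α) (hb : b ≠ α) :
    a.descFactorial 2 * b.descFactorial 2 < α.descFactorial 2 * β.descFactorial 2 := by
  have key := descFactorial_mul_le h h1 h2 1
  simp only [Nat.descFactorial_one] at key
  have e : ∀ x : ℕ, x.descFactorial 2 = (x - 1) * x := by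
    intro x; simp [Nat.descFactorial_succ]
  simp only [e]
  have key2 : (a - 1) * (b - 1) < (α - 1) * (β - 1) := by
    obtain ⟨α, rfl⟩ := Nat.exists_eq_add_of_le' hα
    obtain ⟨β, rfl⟩ := Nat.exists_eq_add_of_le' (hα.trans h1)
    rcases Nat.eq_zero_or_pos a with rfl | ha0
    · simp
    rcases Nat.eq_zero_or_pos b with rfl | hb0
    · simp
    obtain ⟨a, rfl⟩ := Nat.exists_eq_add_of_le' ha0
    obtain ⟨b, rfl⟩ := Nat.exists_eq_add_of_le' hb0
    have e1 : α + 2 - 1 = α + 1 := rfl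
    have e2 : β + 2 - 1 = β + 1 := rfl
    rw [e1, e2, Nat.add_sub_cancel, Nat.add_sub_cancel]
    have hab : a + 1 < b ∨ b + 1 < a := by omega
    have : β = α ∨ β = α + 1 := by omega
    rcases this with rfl | rfl
    · rcases hab with hab | hab <;> (zify at h hab ⊢; nlinarith)
    · rcases hab with hab | hab <;> (zify at h hab ⊢; nlinarith)
  have hpos : 0 < α * β := Nat.mul_pos (by omega) (by omega)
  calc (a - 1) * a * ((b - 1) * b) = ((a - 1) * (b - 1)) * (a * b) := by ring
    _ ≤ ((a - 1) * (b - 1)) * (α * β) := Nat.mul_le_mul_left _ key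
    _ < ((α - 1) * (β - 1)) * (α * β) := Nat.mul_lt_mul_of_pos_right key2 hpos
    _ = _ := by ring

/-! ### Cycles in complete bipartite graphs. -/

theorem completeBipartiteGraph_adj_iff {α β : Type*} (u v : α ⊕ β) :
    (completeBipartiteGraph α β).Adj u v ↔ u.isLeft ≠ v.isLeft := by
  cases u <;> cases v <;> simp

/-- The 2-colouring of a complete bipartite graph by its parts. -/
def sideColoring (α β : Type*) : (completeBipartiteGraph α β).Coloring Bool :=
  Coloring.mk Sum.isLeft fun h => (completeBipartiteGraph_adj_iff _ _).1 h

theorem card_sideColoring_true (α β : Type*) :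
    Nat.card {v // sideColoring α β v = true} = Nat.card α := by
  refine (Nat.card_congr (Equiv.ofBijective (fun a => ⟨Sum.inl a, rfl⟩) ⟨?_, ?_⟩)).symm
  · intro a b h
    exact Sum.inl_injective (congrArg Subtype.val h)
  · rintro ⟨a | b, h⟩
    · exact ⟨a, rfl⟩
    · exact absurd h Bool.false_ne_true

theorem card_sideColoring_false (α β : Type*) :
    Nat.card {v // sideColoring α β v = false} = Nat.card β := by
  refine (Nat.card_congr (Equiv.ofBijective (fun a => ⟨Sum.inr a, rfl⟩) ⟨?_, ?_⟩)).symm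
  · intro a b h
    exact Sum.inr_injective (congrArg Subtype.val h)
  · rintro ⟨a | b, h⟩
    · exact absurd h.symm Bool.false_ne_true
    · exact ⟨b, rfl⟩

theorem card_copy_completeBipartite (a b m : ℕ) :
    Nat.card (Copy (cycleGraph (m + 3)) (completeBipartiteGraph (Fin a) (Fin b))) =
      ∑ s : (cycleGraph (m + 3)).Coloring Bool,
        a.descFactorial (Nat.card {i // s i = true}) *
        b.descFactorial (Nat.card {i // s i = true}) := by
  rw [card_copy_cycleGraph_eq (sideColoring (Fin a) (Fin b))
    (fun u v h => (completeBipartiteGraph_adj_iff u v).2 h) m,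
    card_sideColoring_true, card_sideColoring_false, Nat.card_fin, Nat.card_fin]

theorem card_true_fiber_of_even (k : ℕ) (hk : 2 ≤ k)
    (s : (cycleGraph (2 * k - 3 + 3)).Coloring Bool) :
    Nat.card {i // s i = true} = k := by
  have h1 := card_bool_fibers_cycleGraph _ s
  have h2 := card_bool_fibers_add s
  rw [Fintype.card_fin] at h2
  omega

theorem two_le_card_coloring_even (k : ℕ) (hk : 2 ≤ k) :
    2 ≤ Fintype.card ((cycleGraph (2 * k - 3 + 3)).Coloring Bool) := by
  have hev : Even (2 * k - 3 + 3) := ⟨k, by omega⟩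
  let s := cycleGraph.bicoloring_of_even _ hev
  let s' : (cycleGraph (2 * k - 3 + 3)).Coloring Bool :=
    Coloring.mk (fun i => !(s i)) fun h => by simpa using s.valid h
  have hne : s ≠ s' := by
    intro h
    have h0 : s 0 = !(s 0) := congrArg (fun c : (cycleGraph (2 * k - 3 + 3)).Coloring Bool => c 0) h
    cases hs : s 0 <;> rw [hs] at h0 <;> exact absurd h0 (by decide)
  have := Fintype.one_lt_card_iff.2 ⟨s, s', hne⟩
  omega

/-- At least two colourings of the `2k`-cycle contribute to the copies, and each cycle accounts for
at most `4k` copies. -/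
theorem descFactorial_mul_le_cycleCountOfLength (a b k : ℕ) (hk : 2 ≤ k) :
    a.descFactorial k * b.descFactorial k ≤
      2 * k * cycleCountOfLength (completeBipartiteGraph (Fin a) (Fin b)) (2 * k) := by
  have h1 := card_copy_completeBipartite a b (2 * k - 3)
  simp_rw [card_true_fiber_of_even k hk] at h1
  rw [Finset.sum_const, smul_eq_mul, Finset.card_univ, card_copy_cycleGraph] at h1
  have h2 := two_le_card_coloring_even k hk
  have h3 := card_aut_cycleGraph_le (2 * k - 3)
  have h4 := Nat.mul_le_mul_right (a.descFactorial k * b.descFactorial k) h2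
  rw [← h1] at h4
  have h5 : 2 * k - 3 + 3 = 2 * k := by omega
  rw [h5] at h4 h3
  have h6 := Nat.mul_le_mul_left
    (cycleCountOfLength (completeBipartiteGraph (Fin a) (Fin b)) (2 * k)) h3
  linarith

theorem nonempty_iso_completeBipartite {V : Type*} [Fintype V] {G : SimpleGraph V}
    (col : G.Coloring Bool) (hG : ∀ u v, col u ≠ col v → G.Adj u v) (a b : ℕ)
    (ha : Nat.card {v // col v = true} = a) (hb : Nat.card {v // col v = false} = b) :
    Nonempty (G ≃g completeBipartiteGraph (Fin a) (Fin b)) := by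
  classical
  have e1 : {v // col v = true} ≃ Fin a := Finite.equivFinOfCardEq ha
  have hb' : Nat.card {v // ¬ col v = true} = b := by simpa using hb
  have e2 : {v // ¬ col v = true} ≃ Fin b := Finite.equivFinOfCardEq hb'
  let e : V ≃ Fin a ⊕ Fin b := (Equiv.sumCompl (fun v => col v = true)).symm.trans
    (Equiv.sumCongr e1 e2)
  have he : ∀ v, (e v).isLeft = col v := by
    intro v
    by_cases hv : col v = true
    · simp [e, hv]
    · simp [e, hv]
  refine ⟨⟨e, fun {u v} => ?_⟩⟩
  rw [completeBipartiteGraph_adj_iff, he, he]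
  exact ⟨hG u v, fun h => col.valid h⟩

theorem cycleCountOfLength_le_of_card_copy_le {V W : Type*} [Finite V] [Finite W]
    {G : SimpleGraph V} {K : SimpleGraph W} {m : ℕ}
    (h : Nat.card (Copy (cycleGraph m) G) ≤ Nat.card (Copy (cycleGraph m) K)) :
    cycleCountOfLength G m ≤ cycleCountOfLength K m := by
  rw [card_copy_cycleGraph, card_copy_cycleGraph] at h
  exact Nat.le_of_mul_le_mul_right h (card_aut_cycleGraph_pos m)

theorem cycleCountOfLength_lt_of_card_copy_lt {V W : Type*} [Finite V] [Finite W]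
    {G : SimpleGraph V} {K : SimpleGraph W} {m : ℕ}
    (h : Nat.card (Copy (cycleGraph m) G) < Nat.card (Copy (cycleGraph m) K)) :
    cycleCountOfLength G m < cycleCountOfLength K m := by
  rw [card_copy_cycleGraph, card_copy_cycleGraph] at h
  exact Nat.lt_of_mul_lt_mul_right h

theorem card_balanced (n : ℕ) : Nat.card (Fin (n / 2) ⊕ Fin ((n + 1) / 2)) = n := by
  rw [Nat.card_sum, Nat.card_fin, Nat.card_fin]
  omega

/-! ### The bipartite case. -/

theorem cycleCount_lt_balanced_of_coloring {n : ℕ} (hn : 4 ≤ n) {V : Type*} [Fintype V]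
    (G : SimpleGraph V) (hV : Fintype.card V = n) (col : G.Coloring Bool)
    (hiso : ¬ Nonempty (G ≃g balancedCompleteBipartite n)) :
    cycleCount G < cycleCount (balancedCompleteBipartite n) := by
  classical
  set a := Nat.card {v // col v = true} with ha
  set b := Nat.card {v // col v = false} with hb
  have hab : a + b = n / 2 + (n + 1) / 2 := by
    have := card_bool_fibers_add (fun v => col v)
    rw [hV] at this
    omega
  have h1 : n / 2 ≤ (n + 1) / 2 := by omega
  have h2 : (n + 1) / 2 ≤ n / 2 + 1 := by omega
  have hle : ∀ p, a.descFactorial p * b.descFactorial p ≤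
      (n / 2).descFactorial p * ((n + 1) / 2).descFactorial p := descFactorial_mul_le hab h1 h2
  rw [cycleCount_eq_sum G n (by rw [Nat.card_eq_fintype_card, hV]),
    cycleCount_eq_sum _ n (card_balanced n)]
  refine Finset.sum_lt_sum (fun m hm => ?_) ⟨4, Finset.mem_Icc.2 ⟨by norm_num, hn⟩, ?_⟩
  · obtain ⟨m, rfl⟩ := Nat.exists_eq_add_of_le' (Finset.mem_Icc.1 hm).1
    apply cycleCountOfLength_le_of_card_copy_le
    rw [card_copy_completeBipartite]
    exact (card_copy_cycleGraph_le col m).trans (Finset.sum_le_sum fun s _ => hle _)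
  · apply cycleCountOfLength_lt_of_card_copy_lt
    refine lt_of_lt_of_eq ?_ (card_copy_completeBipartite _ _ 1).symm
    by_cases hsize : a ≠ n / 2 ∧ b ≠ n / 2
    · refine (card_copy_cycleGraph_le col 1).trans_lt
        (Finset.sum_lt_sum (fun s _ => hle _) ?_)
      have hpos := two_le_card_coloring_even 2 le_rfl
      obtain ⟨s⟩ : Nonempty ((cycleGraph (1 + 3)).Coloring Bool) :=
        Fintype.card_pos_iff.1 (two_pos.trans_le hpos)
      refine ⟨s, Finset.mem_univ _, ?_⟩
      have hs : Nat.card {i // s i = true} = 2 := card_true_fiber_of_even 2 le_rfl s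
      rw [hs]
      exact descFactorial_two_mul_lt hab h1 h2 (by omega) hsize.1 hsize.2
    -- Here the classes are balanced, possibly with the colours swapped. If all bichromatic pairs
    -- were edges, `G` would be the balanced graph.
    · have hex : ∃ x y, col x ≠ col y ∧ ¬ G.Adj x y := by
        by_contra! hcon
        apply hiso
        by_cases haa : a = n / 2
        · exact nonempty_iso_completeBipartite col hcon _ _ haa (by omega)
        · have hbb : b = n / 2 := by
            by_contra hbb
            exact hsize ⟨haa, hbb⟩
          let col' : G.Coloring Bool := Coloring.mk (fun v => !(col v)) fun h => by
            simpa using col.valid h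
          have hc : ∀ v, col' v = !(col v) := fun v => rfl
          refine nonempty_iso_completeBipartite col' (fun u v h => hcon u v ?_) _ _ ?_ ?_
          · simpa [hc] using h
          · simpa only [hc, Bool.not_eq_true', ← hb] using hbb
          · simp only [hc, Bool.not_eq_false', ← ha]
            omega
      obtain ⟨x, y, hxy, hadj⟩ := hex
      exact (card_copy_four_lt col (by omega) (by omega) hxy hadj).trans_le
        (Finset.sum_le_sum fun s _ => hle _)

/-! ### Counting paths in triangle-free graphs. -/

open Classical in
/-- The number of paths from `y` to `z` with at most `k` interior vertices, all of them in `R`. -/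
noncomputable def pathCount {V : Type*} (G : SimpleGraph V) (z : V) : ℕ → V → Finset V → ℕ
  | 0, y, _ => if G.Adj y z then 1 else 0
  | k + 1, y, R => (if G.Adj y z then 1 else 0) +
      ∑ a ∈ R with G.Adj y a, pathCount G z k a (R.erase a)

/-- A bound for the number of paths between two vertices with `r` possible interior vertices in
a triangle-free graph. -/
def pathBound : ℕ → ℕ
  | 0 => 1
  | 1 => 1
  | 2 => 2
  | 3 => 4
  | 4 => 9
  | r + 5 => (r + 6) / 2 + (r + 5) / 2 * ((r + 6) / 2) * pathBound (r + 3)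

theorem pathBound_add_two {r : ℕ} (hr : r ≠ 2) :
    pathBound (r + 2) = (r + 3) / 2 + (r + 2) / 2 * ((r + 3) / 2) * pathBound r := by
  match r with
  | 0 => rfl
  | 1 => rfl
  | 2 => exact absurd rfl hr
  | r + 3 => rw [pathBound]

theorem one_le_pathBound (r : ℕ) : 1 ≤ pathBound r := by
  rcases Nat.lt_or_ge r 5 with h | h
  · interval_cases r <;> decide
  · obtain ⟨r, rfl⟩ := Nat.exists_eq_add_of_le' h
    rw [pathBound]
    omega

/-- The maximum over `d` is at `d = ⌈r/2⌉`: beyond it, each unit gained in the linear term costs at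
least one unit of `d * (r - d)`, hence at least `s ≥ 1`. -/
theorem add_mul_sub_mul_le {r d s : ℕ} (hd : d ≤ r) (hs : 1 ≤ s) :
    d + d * (r - d) * s ≤ (r + 1) / 2 + r / 2 * ((r + 1) / 2) * s := by
  obtain ⟨e, rfl⟩ := Nat.exists_eq_add_of_le hd
  rw [Nat.add_sub_cancel_left]
  obtain ⟨α, hα⟩ : ∃ α, α = (d + e) / 2 := ⟨_, rfl⟩
  obtain ⟨β, hβ⟩ : ∃ β, β = (d + e + 1) / 2 := ⟨_, rfl⟩
  rw [← hα, ← hβ]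
  have h1 : d + e = α + β := by omega
  have h2 : β = α ∨ β = α + 1 := by omega
  rcases Nat.lt_or_ge β d with hlt | hge
  · obtain ⟨t, rfl⟩ := Nat.exists_eq_add_of_lt hlt
    have h3 : α = e + t + 1 := by omega
    have key : (β + t + 1) * e + (t + 1) ≤ α * β := by
      rcases h2 with h2 | h2 <;> rw [h2, h3] <;> nlinarith
    have := Nat.mul_le_mul_right s key
    nlinarith
  · have key : d * e ≤ α * β := by
      rcases h2 with h2 | h2
      · have h4 : d + e = 2 * α := by omega
        rw [h2]; zify at h4 ⊢; nlinarith [sq_nonneg ((d : ℤ) - e)]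
      · have h4 : d ≤ α ∨ d = α + 1 := by omega
        obtain ⟨t, ht⟩ := Nat.exists_eq_add_of_le hge
        have : e = α + t := by omega
        have h5 : d * t ≤ α * t := by
          rcases h4 with h4 | h4
          · exact Nat.mul_le_mul_right _ h4
          · have : t = 0 := by omega
            simp [this]
        rw [this, ht]; nlinarith
    have := Nat.mul_le_mul_right s key
    omega

section
variable {V : Type*} {G : SimpleGraph V}

theorem not_adj_of_cliqueFree_three (hG : G.CliqueFree 3) {x y w : V} (h1 : G.Adj x y)
    (h2 : G.Adj y w) : ¬ G.Adj x w := by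
  classical
  intro h3
  exact hG {x, y, w} (is3Clique_triple_iff.2 ⟨h1, h3, h2⟩)

open Classical in
theorem card_filter_adj_le (hG : G.CliqueFree 3) (R : Finset V) {y a : V}
    (ha : a ∈ R.filter (G.Adj y)) (R' : Finset V) (hR' : R' ⊆ R) :
    (R'.filter (G.Adj a)).card ≤ R.card - (R.filter (G.Adj y)).card := by
  rw [← Finset.card_sdiff_of_subset (Finset.filter_subset _ _)]
  refine Finset.card_le_card fun b hb => ?_
  rw [Finset.mem_filter] at ha hb
  rw [Finset.mem_sdiff, Finset.mem_filter]
  exact ⟨hR' hb.1, fun h => not_adj_of_cliqueFree_three hG ha.2 hb.2 h.2⟩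

-- This counts paths from `y` to `z` with at most one interior vertex. If `y` and `z` are adjacent,
-- triangle-freeness forbids a common neighbour, so the two kinds of path exclude each other.
open Classical in
theorem closings_le (hG : G.CliqueFree 3) (R : Finset V) (y z : V) :
    (if G.Adj y z then 1 else 0) + ∑ a ∈ R with G.Adj y a, (if G.Adj a z then 1 else 0) ≤
      max 1 (R.filter (G.Adj y)).card := by
  split_ifs with h
  · rw [Finset.sum_eq_zero]
    · exact le_max_left _ _
    · intro a ha
      rw [if_neg]
      exact fun h' => not_adj_of_cliqueFree_three hG (Finset.mem_filter.1 ha).2 h' h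
  · rw [zero_add, Finset.card_eq_sum_ones]
    refine le_max_of_le_right (Finset.sum_le_sum fun a _ => ?_)
    split_ifs <;> simp

/-- Two steps are taken at once: if `y` has `d` neighbours in `R`, a neighbour `a` of `y` has none
of them as its own neighbour, leaving at most `r + 2 - d` choices for the next vertex. -/
theorem pathCount_add_two_le (hG : G.CliqueFree 3) (z y : V) (r : ℕ) (R : Finset V)
    (hR : R.card = r + 2) (s : ℕ) (hs : 1 ≤ s)
    (ih : ∀ (b : V) (R' : Finset V), R'.card = r → pathCount G z r b R' ≤ s) :
    pathCount G z (r + 2) y R ≤ (r + 3) / 2 + (r + 2) / 2 * ((r + 3) / 2) * s := by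
  classical
  set d := (R.filter (G.Adj y)).card with hd
  have hdr : d ≤ r + 2 := hR ▸ Finset.card_filter_le _ _
  have inner : ∀ a ∈ R.filter (G.Adj y),
      ∑ b ∈ R.erase a with G.Adj a b, pathCount G z r b ((R.erase a).erase b) ≤
        (r + 2 - d) * s := by
    intro a ha
    calc _ ≤ ∑ b ∈ R.erase a with G.Adj a b, s := by
          refine Finset.sum_le_sum fun b hb => ih _ _ ?_
          rw [Finset.card_erase_of_mem (Finset.mem_filter.1 hb).1,
            Finset.card_erase_of_mem (Finset.mem_filter.1 ha).1, hR]
          rfl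
      _ = ((R.erase a).filter (G.Adj a)).card * s := by rw [Finset.sum_const, smul_eq_mul]
      _ ≤ _ := by
          refine Nat.mul_le_mul_right _ ?_
          rw [← hR]
          exact card_filter_adj_le hG R ha _ (Finset.erase_subset _ _)
  have total : pathCount G z (r + 2) y R ≤ max 1 d + d * (r + 2 - d) * s := by
    calc pathCount G z (r + 2) y R
        = ((if G.Adj y z then 1 else 0) +
          ∑ a ∈ R with G.Adj y a, (if G.Adj a z then 1 else 0)) +
          ∑ a ∈ R with G.Adj y a, ∑ b ∈ R.erase a with G.Adj a b,
            pathCount G z r b ((R.erase a).erase b) := by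
          rw [add_assoc, ← Finset.sum_add_distrib]
          rfl
      _ ≤ max 1 d + ∑ a ∈ R with G.Adj y a, (r + 2 - d) * s :=
          Nat.add_le_add (closings_le hG R y z) (Finset.sum_le_sum inner)
      _ = _ := by rw [Finset.sum_const, smul_eq_mul, mul_assoc]
  have := add_mul_sub_mul_le hdr hs
  -- For `d = 0` the closing term is `max 1 0 = 1` rather than `d`, but `(r + 3) / 2 ≥ 1` covers it.
  rcases Nat.eq_zero_or_pos d with h0 | h0
  · rw [h0] at total
    simp only [zero_le, sup_of_le_left, zero_mul, add_zero] at total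
    omega
  · rw [max_eq_right h0] at total
    exact total.trans this

theorem pathCount_zero_le (z y : V) (R : Finset V) : pathCount G z 0 y R ≤ 1 := by
  rw [pathCount]
  split_ifs <;> simp

theorem pathCount_two_le (hG : G.CliqueFree 3) (z y : V) (R : Finset V) (hR : R.card = 2) :
    pathCount G z 2 y R ≤ 2 :=
  pathCount_add_two_le hG z y 0 R hR 1 le_rfl fun b R' _ => pathCount_zero_le z b R'

theorem pathCount_one_le (hG : G.CliqueFree 3) (z y : V) (R : Finset V) (hR : R.card = 1) :
    pathCount G z 1 y R ≤ 1 := by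
  classical
  refine (closings_le hG R y z).trans ?_
  rw [← hR]
  exact max_le (hR ▸ le_rfl) (Finset.card_filter_le _ _)

/-- The two-step recursion would give 10. The saving is needed: it propagates to a constant factor
in `pathBound` at all even arguments, and without it the odd case of the final comparison fails. -/
theorem pathCount_four_le (hG : G.CliqueFree 3) (z y : V) (R : Finset V) (hR : R.card = 4) :
    pathCount G z 4 y R ≤ 9 := by
  classical
  set Y := R.filter (G.Adj y) with hY
  have hYR : Y ⊆ R := Finset.filter_subset _ _
  have hd4 : Y.card ≤ 4 := hR ▸ Finset.card_le_card hYR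
  have expand : pathCount G z 4 y R = ((if G.Adj y z then 1 else 0) +
      ∑ a ∈ Y, (if G.Adj a z then 1 else 0)) + ∑ a ∈ Y, ∑ b ∈ R.erase a with G.Adj a b,
            pathCount G z 2 b ((R.erase a).erase b) := by
    rw [add_assoc, ← Finset.sum_add_distrib]
    rfl
  have hcard : ∀ a ∈ Y, ∀ b ∈ (R.erase a).filter (G.Adj a), ((R.erase a).erase b).card = 2 := by
    intro a ha b hb
    rw [Finset.card_erase_of_mem (Finset.mem_filter.1 hb).1, Finset.card_erase_of_mem (hYR ha), hR]
  have innerB : ∀ a ∈ Y, ∑ b ∈ R.erase a with G.Adj a b,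
      pathCount G z 2 b ((R.erase a).erase b) ≤ ((R.erase a).filter (G.Adj a)).card * 2 := by
    intro a ha
    rw [← smul_eq_mul, ← Finset.sum_const]
    exact Finset.sum_le_sum fun b hb => pathCount_two_le hG _ _ _ (hcard a ha b hb)
  have hB : ∀ a ∈ Y, ((R.erase a).filter (G.Adj a)).card ≤ 4 - Y.card := fun a ha => by
    rw [← hR]
    exact card_filter_adj_le hG R ha _ (Finset.erase_subset _ _)
  have inner : ∀ a ∈ Y, ∑ b ∈ R.erase a with G.Adj a b,
      pathCount G z 2 b ((R.erase a).erase b) ≤ (4 - Y.card) * 2 := fun a ha =>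
    (innerB a ha).trans (Nat.mul_le_mul_right _ (hB a ha))
  have gen : pathCount G z 4 y R ≤ max 1 Y.card + Y.card * ((4 - Y.card) * 2) := by
    rw [expand]
    refine Nat.add_le_add (closings_le hG R y z) ?_
    rw [← smul_eq_mul, ← Finset.sum_const]
    exact Finset.sum_le_sum inner
  by_cases h2 : Y.card = 2
  swap
  · refine gen.trans ?_
    generalize Y.card = d at *
    interval_cases d <;> simp_all
  rw [expand, add_assoc, ← Finset.sum_add_distrib]
  -- With `d = 2` the count is at most 1 for the edge `y z` plus 4 for each of the two first steps.
  -- If `a` is adjacent to `z`, the one path gained by closing is outweighed, because no other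
  -- neighbour of `a` can then close to `z`.
  have each : ∀ a ∈ Y, (if G.Adj a z then 1 else 0) + ∑ b ∈ R.erase a with G.Adj a b,
      pathCount G z 2 b ((R.erase a).erase b) ≤ 4 := by
    intro a ha
    split_ifs with haz
    swap
    · have := inner a ha
      rw [h2] at this
      omega
    suffices ∑ b ∈ R.erase a with G.Adj a b, pathCount G z 2 b ((R.erase a).erase b) ≤ 2 by omega
    rcases Nat.lt_or_ge ((R.erase a).filter (G.Adj a)).card 2 with hlt | hge
    · have := innerB a ha
      omega
    have hsub : (R.erase a).filter (G.Adj a) ⊆ R \ Y := by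
      intro b hb
      rw [Finset.mem_filter, Finset.mem_erase] at hb
      rw [Finset.mem_sdiff]
      exact ⟨hb.1.2, fun h => not_adj_of_cliqueFree_three hG (Finset.mem_filter.1 ha).2 hb.2
        (Finset.mem_filter.1 h).2⟩
    have hBeq : (R.erase a).filter (G.Adj a) = R \ Y := by
      refine Finset.eq_of_subset_of_card_le hsub ?_
      rw [Finset.card_sdiff_of_subset hYR, hR, h2]
      exact hge
    have hYa : (Y.erase a).card = 1 := by rw [Finset.card_erase_of_mem ha, h2]
    have one : ∀ b ∈ (R.erase a).filter (G.Adj a),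
        pathCount G z 2 b ((R.erase a).erase b) ≤ 1 := by
      intro b hb
      have hab := (Finset.mem_filter.1 hb).2
      have hbz : ¬ G.Adj b z := fun h => not_adj_of_cliqueFree_three hG hab h haz
      have hfar : ∀ c ∈ (R.erase a).erase b, c ∉ Y → G.Adj a c := by
        intro c hc hcY
        rw [Finset.mem_erase, Finset.mem_erase] at hc
        have : c ∈ R \ Y := Finset.mem_sdiff.2 ⟨hc.2.2, hcY⟩
        rw [← hBeq] at this
        exact (Finset.mem_filter.1 this).2
      have hc : ∀ c ∈ ((R.erase a).erase b).filter (G.Adj b), c ∈ Y.erase a := by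
        intro c hc
        rw [Finset.mem_filter] at hc
        rw [Finset.mem_erase]
        have hca := Finset.ne_of_mem_erase (Finset.mem_of_mem_erase hc.1)
        refine ⟨hca, ?_⟩
        by_contra hcY
        exact not_adj_of_cliqueFree_three hG hab hc.2 (hfar c hc.1 hcY)
      rw [pathCount, if_neg hbz, zero_add]
      calc _ ≤ ∑ c ∈ ((R.erase a).erase b).filter (G.Adj b), 1 := by
            refine Finset.sum_le_sum fun c hcm => ?_
            rw [pathCount]
            rw [Finset.sum_eq_zero]
            · split_ifs <;> simp
            intro e he
            rw [pathCount, if_neg]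
            intro hez
            rw [Finset.mem_filter] at he
            have heR := Finset.mem_of_mem_erase he.1
            have hea := Finset.ne_of_mem_erase (Finset.mem_of_mem_erase heR)
            -- `c` is already the only vertex of `Y` other than `a`, so `e` lies outside `Y` and is
            -- adjacent to `a`; being adjacent to `z` as well would make a triangle with `a` and
            -- `z`.
            have heY : e ∉ Y := by
              intro heY
              obtain ⟨w, hw⟩ := Finset.card_eq_one.1 hYa
              have h1 := hc c hcm
              have h2 : e ∈ Y.erase a := Finset.mem_erase.2 ⟨hea, heY⟩
              rw [hw, Finset.mem_singleton] at h1 h2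
              exact he.2.ne (h1.trans h2.symm)
            exact not_adj_of_cliqueFree_three hG (hfar e heR heY) hez haz
        _ ≤ 1 := by
            rw [Finset.sum_const, smul_eq_mul, mul_one, ← hYa]
            exact Finset.card_le_card hc
    calc _ ≤ ∑ b ∈ R.erase a with G.Adj a b, 1 := Finset.sum_le_sum one
      _ = (R \ Y).card := by rw [hBeq, Finset.sum_const, smul_eq_mul, mul_one]
      _ ≤ 2 := by rw [Finset.card_sdiff_of_subset hYR, hR, h2]
  have := Finset.sum_le_sum each
  rw [Finset.sum_const, h2, smul_eq_mul] at this
  have : (if G.Adj y z then 1 else 0) ≤ 1 := by split_ifs <;> simp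
  omega

theorem pathCount_le_pathBound (hG : G.CliqueFree 3) (z : V) (r : ℕ) :
    ∀ (y : V) (R : Finset V), R.card = r → pathCount G z r y R ≤ pathBound r := by
  induction r using Nat.twoStepInduction with
  | zero => exact fun y R _ => pathCount_zero_le z y R
  | one => exact fun y R hR => pathCount_one_le hG z y R hR
  | more r ih _ =>
    intro y R hR
    by_cases hr : r = 2
    · subst hr
      exact pathCount_four_le hG z y R hR
    · rw [pathBound_add_two hr]
      exact pathCount_add_two_le hG z y r R hR _ (one_le_pathBound r) ih

end

/-! ### Encoding the cycles through a vertex. -/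

section
variable {V : Type*} (G : SimpleGraph V)

open Classical in
/-- The lists of interior vertices of the paths counted by `pathCount`. -/
noncomputable def pathLists (z : V) : ℕ → V → Finset V → Finset (List V)
  | 0, y, _ => if G.Adj y z then {[]} else ∅
  | k + 1, y, R => (if G.Adj y z then {[]} else ∅) ∪
      (R.filter (G.Adj y)).biUnion fun a => (pathLists z k a (R.erase a)).image (a :: ·)

theorem card_pathLists_le (z : V) (k : ℕ) : ∀ (y : V) (R : Finset V),
    (pathLists G z k y R).card ≤ pathCount G z k y R := by
  classical
  have h0 : ∀ y, (if G.Adj y z then {[]} else ∅ : Finset (List V)).card ≤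
      if G.Adj y z then 1 else 0 := by
    intro y
    split_ifs <;> simp
  induction k with
  | zero => exact fun y R => h0 y
  | succ k ih =>
    intro y R
    rw [pathLists, pathCount]
    refine (Finset.card_union_le _ _).trans (Nat.add_le_add (h0 y) ?_)
    refine Finset.card_biUnion_le.trans (Finset.sum_le_sum fun a _ => ?_)
    exact Finset.card_image_le.trans (ih a _)

variable {G}

theorem mem_pathLists (z : V) (l : List V) : ∀ (k : ℕ) (y : V) (R : Finset V), R.card = k →
    l.Nodup → (∀ x ∈ l, x ∈ R) → (y :: (l ++ [z])).IsChain G.Adj → l ∈ pathLists G z k y R := by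
  classical
  induction l with
  | nil =>
    intro k y R _ _ _ hc
    have h : G.Adj y z := by simpa using hc
    cases k <;> simp [pathLists, h]
  | cons a l ih =>
    intro k y R hk hn hR hc
    have haR := hR a (by simp)
    rw [List.cons_append, List.isChain_cons_cons] at hc
    rw [List.nodup_cons] at hn
    match k with
    | 0 => exact absurd haR (by rw [Finset.card_eq_zero.1 hk]; simp)
    | k + 1 =>
      rw [pathLists, Finset.mem_union, Finset.mem_biUnion]
      refine Or.inr ⟨a, Finset.mem_filter.2 ⟨haR, hc.1⟩, Finset.mem_image.2 ⟨l, ?_, rfl⟩⟩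
      refine ih k a _ ?_ hn.2 (fun x hx => ?_) hc.2
      · rw [Finset.card_erase_of_mem haR, hk]
        rfl
      · exact Finset.mem_erase.2 ⟨fun h => hn.1 (h ▸ hx), hR x (by simp [hx])⟩

/-- The injective map `g` runs once around the subgraph `H`. -/
structure Traverses (H : G.Subgraph) {m : ℕ} (g : Fin (m + 3) → V) : Prop where
  inj : Function.Injective g
  mem_verts : ∀ a, a ∈ H.verts ↔ ∃ i, g i = a
  adj_iff : ∀ a b, H.Adj a b ↔ ∃ i, (g i = a ∧ g (i + 1) = b) ∨ (g i = b ∧ g (i + 1) = a)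

theorem Traverses.ext {H H' : G.Subgraph} {m : ℕ} {g : Fin (m + 3) → V} (h : Traverses H g)
    (h' : Traverses H' g) : H = H' := by
  ext a b
  · rw [h.mem_verts, h'.mem_verts]
  · rw [h.adj_iff, h'.adj_iff]

theorem Traverses.rotate {H : G.Subgraph} {m : ℕ} {g : Fin (m + 3) → V} (h : Traverses H g)
    (j : Fin (m + 3)) : Traverses H (fun i => g (i + j)) where
  inj := h.inj.comp (add_left_injective j)
  mem_verts a := by
    rw [h.mem_verts]
    exact ⟨fun ⟨i, hi⟩ => ⟨i - j, by rw [sub_add_cancel, hi]⟩, fun ⟨i, hi⟩ => ⟨_, hi⟩⟩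
  adj_iff a b := by
    rw [h.adj_iff]
    constructor
    · rintro ⟨i, hi⟩
      refine ⟨i - j, ?_⟩
      rwa [sub_add_cancel, add_right_comm, sub_add_cancel]
    · rintro ⟨i, hi⟩
      refine ⟨i + j, ?_⟩
      rwa [add_right_comm] at hi

theorem Traverses.reflect {H : G.Subgraph} {m : ℕ} {g : Fin (m + 3) → V} (h : Traverses H g) :
    Traverses H (fun i => g (-i)) where
  inj := h.inj.comp neg_injective
  mem_verts a := by
    rw [h.mem_verts]
    exact ⟨fun ⟨i, hi⟩ => ⟨-i, by rw [neg_neg, hi]⟩, fun ⟨i, hi⟩ => ⟨_, hi⟩⟩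
  adj_iff a b := by
    rw [h.adj_iff]
    constructor
    · rintro ⟨i, hi⟩
      refine ⟨-(i + 1), ?_⟩
      have e : -(-(i + 1) + 1) = i := by abel
      rw [e, neg_neg]
      tauto
    · rintro ⟨i, hi⟩
      refine ⟨-(i + 1), ?_⟩
      have e : -(i + 1) + 1 = -i := by abel
      rw [e]
      tauto

theorem exists_traverses {H : G.Subgraph} (hH : IsCycleSubgraph H) :
    ∃ (m : ℕ) (g : Fin (m + 3) → V), Traverses H g := by
  obtain ⟨k, hk, ⟨e⟩⟩ := hH
  obtain ⟨m, rfl⟩ := Nat.exists_eq_add_of_le' hk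
  refine ⟨m, fun i => e i, fun i j h => e.injective (Subtype.ext h), fun a => ⟨fun h => ?_, ?_⟩,
    fun a b => ⟨fun h => ?_, ?_⟩⟩
  · exact ⟨e.symm ⟨a, h⟩, by simp⟩
  · rintro ⟨i, rfl⟩
    exact (e i).2
  · have h1 : H.coe.Adj ⟨a, H.edge_vert h⟩ ⟨b, H.edge_vert h.symm⟩ := h
    obtain ⟨i, hi⟩ := e.surjective ⟨a, H.edge_vert h⟩
    obtain ⟨j, hj⟩ := e.surjective ⟨b, H.edge_vert h.symm⟩
    rw [← hi, ← hj, e.map_adj_iff, cycleGraph_adj] at h1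
    have hi' : (e i : V) = a := by rw [hi]
    have hj' : (e j : V) = b := by rw [hj]
    rcases h1 with h1 | h1
    · exact ⟨j, Or.inr ⟨hj', by rw [← sub_eq_iff_eq_add'.1 h1, hi']⟩⟩
    · exact ⟨i, Or.inl ⟨hi', by rw [← sub_eq_iff_eq_add'.1 h1, hj']⟩⟩
  · have hadj : ∀ i, H.Adj (e i) (e (i + 1)) := by
      intro i
      have : H.coe.Adj (e i) (e (i + 1)) := e.map_adj_iff.2 (by
        rw [cycleGraph_adj]
        right
        simp)
      exact this
    rintro ⟨i, ⟨rfl, rfl⟩ | ⟨rfl, rfl⟩⟩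
    · exact hadj i
    · exact (hadj i).symm

theorem Traverses.adj_succ {H : G.Subgraph} {m : ℕ} {g : Fin (m + 3) → V} (h : Traverses H g)
    (i : Fin (m + 3)) : G.Adj (g i) (g (i + 1)) :=
  H.adj_sub ((h.adj_iff _ _).2 ⟨i, Or.inl ⟨rfl, rfl⟩⟩)

/-- A rotation brings `v` to index 0, and a reflection, if necessary, orders its two neighbours on
the cycle. This fixes the direction, so unordered pairs of neighbours suffice in the count. -/
theorem exists_traverses_from {H : G.Subgraph} (hH : IsCycleSubgraph H) {v : V}
    (hv : v ∈ H.verts) (ρ : V → ℕ) (hρ : Function.Injective ρ) :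
    ∃ (m : ℕ) (g : Fin (m + 3) → V), Traverses H g ∧ g 0 = v ∧ ρ (g 1) < ρ (g (Fin.last _)) := by
  obtain ⟨m, g, hg⟩ := exists_traverses hH
  obtain ⟨j, hj⟩ := (hg.mem_verts v).1 hv
  have h1 := hg.rotate j
  have h2 := h1.reflect
  have hl : -1 = Fin.last (m + 2) := by
    rw [← Fin.neg_last, neg_neg]
  have hl' : -Fin.last (m + 2) = 1 := Fin.neg_last _
  have hne : (1 : Fin (m + 3)) ≠ Fin.last (m + 2) := by
    intro h
    have := congrArg Fin.val h
    simp at this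
  have hne' := fun h => hne (h1.inj (hρ h))
  rcases lt_or_gt_of_ne hne' with h | h
  · exact ⟨m, _, h1, by simp [hj], h⟩
  · refine ⟨m, _, h2, by simp [hj], ?_⟩
    simpa only [hl, hl'] using h

theorem ofFn_eq_cons_concat {m : ℕ} (g : Fin (m + 3) → V) :
    List.ofFn g = g 0 :: g 1 ::
      (List.ofFn (fun i : Fin m => g i.castSucc.succ.succ) ++ [g (Fin.last _)]) := by
  rw [List.ofFn_succ, List.ofFn_succ, List.ofFn_succ', List.concat_eq_append]
  rfl

theorem Traverses.isChain_tail {H : G.Subgraph} {m : ℕ} {g : Fin (m + 3) → V}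
    (h : Traverses H g) : (List.ofFn g).IsChain G.Adj := by
  rw [List.isChain_iff_getElem]
  intro i hi
  rw [List.length_ofFn] at hi
  rw [List.getElem_ofFn, List.getElem_ofFn]
  convert h.adj_succ ⟨i, by omega⟩ using 2
  rw [Fin.ext_iff, Fin.val_add_one_of_lt]
  rw [Fin.lt_def]
  simp
  omega

/-- The cycles of `G` all of whose vertices lie in `U`. -/
def cyclesIn (G : SimpleGraph V) (U : Finset V) : Set G.Subgraph :=
  {H | IsCycleSubgraph H ∧ H.verts ⊆ U}

open Classical in
/-- Codes for the cycles in `U` through `v`: the neighbours `y`, `z` of `v` on the cycle, ordered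
by `ρ`, and the list of vertices between them. -/
noncomputable def cycleCodes (G : SimpleGraph V) (U : Finset V) (v : V) (ρ : V → ℕ) :
    Finset (Σ _ : V × V, List V) :=
  (((U.filter (G.Adj v)) ×ˢ (U.filter (G.Adj v))).filter fun p => ρ p.1 < ρ p.2).sigma
    fun p => pathLists G p.2 (U.card - 3) p.1 (((U.erase v).erase p.1).erase p.2)

theorem two_mul_card_ordered_pairs_le (s : Finset V) (ρ : V → ℕ) :
    2 * ((s ×ˢ s).filter fun p => ρ p.1 < ρ p.2).card ≤ s.card * (s.card - 1) := by
  classical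
  set T := (s ×ˢ s).filter fun p => ρ p.1 < ρ p.2 with hT
  have hdisj : Disjoint T (T.image Prod.swap) := by
    rw [Finset.disjoint_left]
    intro p hp hp'
    obtain ⟨q, hq, rfl⟩ := Finset.mem_image.1 hp'
    have h1 := (Finset.mem_filter.1 hp).2
    have h2 := (Finset.mem_filter.1 hq).2
    simp only [Prod.fst_swap, Prod.snd_swap] at h1
    omega
  have hsub : T ∪ T.image Prod.swap ⊆ s.offDiag := by
    intro p hp
    rw [Finset.mem_offDiag]
    rcases Finset.mem_union.1 hp with hp | hp
    · obtain ⟨h1, h2⟩ := Finset.mem_filter.1 hp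
      rw [Finset.mem_product] at h1
      exact ⟨h1.1, h1.2, fun h => by rw [h] at h2; exact lt_irrefl _ h2⟩
    · obtain ⟨q, hq, rfl⟩ := Finset.mem_image.1 hp
      obtain ⟨h1, h2⟩ := Finset.mem_filter.1 hq
      rw [Finset.mem_product] at h1
      exact ⟨h1.2, h1.1, fun h => by
        simp only [Prod.fst_swap, Prod.snd_swap] at h
        rw [h] at h2; exact lt_irrefl _ h2⟩
  have h := Finset.card_le_card hsub
  rw [Finset.card_union_of_disjoint hdisj, Finset.card_image_of_injective _ Prod.swap_injective,
    Finset.offDiag_card] at h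
  rw [Nat.mul_sub, mul_one]
  omega

open Classical in
theorem card_erase_three {U : Finset V} {v y z : V} (hv : v ∈ U) (hy : y ∈ U) (hz : z ∈ U)
    (hvy : v ≠ y) (hvz : v ≠ z) (hyz : y ≠ z) :
    (((U.erase v).erase y).erase z).card = U.card - 3 := by
  have hy' : y ∈ U.erase v := Finset.mem_erase.2 ⟨hvy.symm, hy⟩
  have hz' : z ∈ (U.erase v).erase y :=
    Finset.mem_erase.2 ⟨hyz.symm, Finset.mem_erase.2 ⟨hvz.symm, hz⟩⟩
  rw [Finset.card_erase_of_mem hz', Finset.card_erase_of_mem hy', Finset.card_erase_of_mem hv]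
  omega

open Classical in
theorem two_mul_card_cycleCodes_le (hG : G.CliqueFree 3) {U : Finset V} {v : V} (hv : v ∈ U)
    (ρ : V → ℕ) :
    2 * (cycleCodes G U v ρ).card ≤ (U.filter (G.Adj v)).card *
      ((U.filter (G.Adj v)).card - 1) * pathBound (U.card - 3) := by
  rw [cycleCodes, Finset.card_sigma]
  calc _ ≤ 2 * ∑ p ∈ ((U.filter (G.Adj v)) ×ˢ (U.filter (G.Adj v))).filter
          fun p => ρ p.1 < ρ p.2, pathBound (U.card - 3) := by
        refine Nat.mul_le_mul_left _ (Finset.sum_le_sum fun p hp => ?_)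
        rw [Finset.mem_filter, Finset.mem_product, Finset.mem_filter, Finset.mem_filter] at hp
        refine (card_pathLists_le _ _ _ _ _).trans (pathCount_le_pathBound hG _ _ _ _ ?_)
        refine card_erase_three hv hp.1.1.1 hp.1.2.1 hp.1.1.2.ne hp.1.2.2.ne fun h => ?_
        rw [h] at hp
        exact lt_irrefl _ hp.2
    _ ≤ _ := by
        rw [Finset.sum_const, smul_eq_mul, ← mul_assoc]
        exact Nat.mul_le_mul_right _ (two_mul_card_ordered_pairs_le _ ρ)

theorem exists_cycleCode {U : Finset V} {v : V} (ρ : V → ℕ) (hρ : Function.Injective ρ)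
    {H : G.Subgraph} (hH : IsCycleSubgraph H) (hHU : H.verts ⊆ U) (hv : v ∈ H.verts) :
    ∃ c ∈ cycleCodes G U v ρ, ∃ (m : ℕ) (g : Fin (m + 3) → V), Traverses H g ∧
      List.ofFn g = v :: c.1.1 :: (c.2 ++ [c.1.2]) := by
  classical
  obtain ⟨m, g, hg, h0, hlt⟩ := exists_traverses_from hH hv ρ hρ
  have hU : ∀ i, g i ∈ U := fun i => hHU ((hg.mem_verts _).2 ⟨i, rfl⟩)
  have hlist := ofFn_eq_cons_concat g
  have hchain := hg.isChain_tail
  have hnodup := List.nodup_ofFn.2 hg.inj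
  have hvz : G.Adj v (g (Fin.last _)) := by
    have := hg.adj_succ (Fin.last _)
    rw [Fin.last_add_one, h0] at this
    exact this.symm
  have hvy : G.Adj v (g 1) := by
    have := hg.adj_succ 0
    rwa [zero_add, h0] at this
  set l := List.ofFn (fun i : Fin m => g i.castSucc.succ.succ) with hl
  rw [hlist, h0] at hnodup
  rw [hlist, List.isChain_cons_cons] at hchain
  refine ⟨⟨(g 1, g (Fin.last _)), l⟩, ?_, m, g, hg, by rw [hlist, h0]⟩
  rw [cycleCodes, Finset.mem_sigma]
  have hv : v ∈ U := h0 ▸ hU 0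
  simp only [List.nodup_cons, List.mem_cons, List.mem_append, List.nodup_append, not_or] at hnodup
  obtain ⟨⟨hn1, hn2, hn3⟩, ⟨hn4, hn5⟩, hn6, -, hn7⟩ := hnodup
  refine ⟨?_, ?_⟩
  · simp only [Finset.mem_filter, Finset.mem_product]
    exact ⟨⟨⟨hU _, hvy⟩, ⟨hU _, hvz⟩⟩, hlt⟩
  · refine mem_pathLists _ l _ _ _ ?_ hn6 ?_ hchain.2
    · exact card_erase_three hv (hU _) (hU _) hvy.ne hvz.ne hn5.1
    · intro x hx
      have hxU : x ∈ U := by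
        rw [hl, List.mem_ofFn] at hx
        obtain ⟨i, rfl⟩ := hx
        exact hU _
      simp only [Finset.mem_erase]
      refine ⟨fun h => hn7 x hx _ (Or.inl rfl) h, fun h => hn4 (h ▸ hx), fun h => hn2 (h ▸ hx), hxU⟩

-- A cycle in `U` either avoids `v` or is recovered from its code, whose list of vertices determines
-- the traversal. The factor 2 avoids halving the number of ordered pairs of neighbours.
open Classical in
theorem ncard_cyclesIn_le [Finite V] (hG : G.CliqueFree 3) {U : Finset V} {v : V} (hv : v ∈ U) :
    2 * (cyclesIn G U).ncard ≤ 2 * (cyclesIn G (U.erase v)).ncard +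
      (U.filter (G.Adj v)).card * ((U.filter (G.Adj v)).card - 1) * pathBound (U.card - 3) := by
  obtain ⟨n, ⟨e⟩⟩ := Finite.exists_equiv_fin V
  let ρ : V → ℕ := fun x => e x
  have hρ : Function.Injective ρ := fun x y h => e.injective (Fin.ext h)
  let D : Set G.Subgraph := {H | IsCycleSubgraph H ∧ H.verts ⊆ U ∧ v ∈ H.verts}
  have hsub : cyclesIn G U ⊆ cyclesIn G (U.erase v) ∪ D := by
    rintro H ⟨hH, hHU⟩
    by_cases hvH : v ∈ H.verts
    · exact Or.inr ⟨hH, hHU, hvH⟩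
    · refine Or.inl ⟨hH, fun x hx => ?_⟩
      rw [Finset.mem_coe, Finset.mem_erase]
      exact ⟨fun h => hvH (h ▸ hx), hHU hx⟩
  have hD : D.ncard ≤ (cycleCodes G U v ρ).card := by
    have key : ∀ H ∈ D, ∃ c ∈ cycleCodes G U v ρ, ∃ (m : ℕ) (g : Fin (m + 3) → V),
        Traverses H g ∧ List.ofFn g = v :: c.1.1 :: (c.2 ++ [c.1.2]) :=
      fun H hH => exists_cycleCode ρ hρ hH.1 hH.2.1 hH.2.2
    have : Nonempty (Σ _ : V × V, List V) := ⟨⟨(v, v), []⟩⟩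
    choose! f hf using key
    rw [← Set.ncard_coe_finset]
    refine Set.ncard_le_ncard_of_injOn f (fun H hH => (hf H hH).1) (fun H hH H' hH' h => ?_)
      (Finset.finite_toSet _)
    obtain ⟨-, m, g, hg, hgl⟩ := hf H hH
    obtain ⟨-, m', g', hg', hgl'⟩ := hf H' hH'
    rw [← h, ← hgl] at hgl'
    have hm : m' = m := by
      have := congrArg List.length hgl'
      simpa using this
    subst hm
    rw [List.ofFn_inj] at hgl'
    subst hgl'
    exact hg.ext hg'
  have h1 := (Set.ncard_le_ncard hsub (Set.toFinite _)).trans (Set.ncard_union_le _ _)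
  have h2 := two_mul_card_cycleCodes_le hG hv ρ
  omega

theorem cycleCount_eq_ncard_cyclesIn [Fintype V] (G : SimpleGraph V) :
    cycleCount G = (cyclesIn G Finset.univ).ncard := by
  rw [cycleCount, cyclesIn]
  simp

/-- A bound for twice the number of cycles in a triangle-free graph on `n` vertices. -/
def cycleBound : ℕ → ℕ
  | 0 => 0
  | n + 1 => cycleBound n + n * (n - 1) * pathBound (n - 2)

/-- Vertices are deleted one at a time using only the trivial degree bound, since this part of the
count is of lower order. -/
theorem ncard_cyclesIn_le_cycleBound [Finite V] (hG : G.CliqueFree 3) (n : ℕ) :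
    ∀ U : Finset V, U.card = n → 2 * (cyclesIn G U).ncard ≤ cycleBound n := by
  classical
  induction n with
  | zero =>
    intro U hU
    have : cyclesIn G U = ∅ := by
      rw [Set.eq_empty_iff_forall_notMem]
      rintro H ⟨hH, hHU⟩
      obtain ⟨m, g, hg⟩ := exists_traverses hH
      have := hHU ((hg.mem_verts _).2 ⟨0, rfl⟩)
      rw [Finset.card_eq_zero.1 hU] at this
      simp at this
    simp [this]
  | succ n ih =>
    intro U hU
    obtain ⟨v, hv⟩ : U.Nonempty := Finset.card_pos.1 (by omega)
    have h1 := ih (U.erase v) (by rw [Finset.card_erase_of_mem hv, hU]; rfl)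
    have h2 := ncard_cyclesIn_le hG hv
    have hd : (U.filter (G.Adj v)).card ≤ n := by
      have : U.filter (G.Adj v) ⊆ U.erase v := by
        intro x hx
        rw [Finset.mem_filter] at hx
        exact Finset.mem_erase.2 ⟨hx.2.ne', hx.1⟩
      have := Finset.card_le_card this
      rwa [Finset.card_erase_of_mem hv, hU] at this
    have h3 : (U.filter (G.Adj v)).card * ((U.filter (G.Adj v)).card - 1) ≤ n * (n - 1) :=
      Nat.mul_le_mul hd (Nat.sub_le_sub_right hd 1)
    have h4 := Nat.mul_le_mul_right (pathBound (U.card - 3)) h3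
    rw [hU] at h2 h4
    rw [cycleBound]
    have e : n + 1 - 3 = n - 2 := by omega
    rw [e] at h2 h4
    omega

open Classical in
theorem two_mul_cycleCount_le [Fintype V] (hG : G.CliqueFree 3) (v : V) :
    2 * cycleCount G ≤ cycleBound (Fintype.card V - 1) +
      G.degree v * (G.degree v - 1) * pathBound (Fintype.card V - 3) := by
  rw [cycleCount_eq_ncard_cyclesIn]
  have h1 := ncard_cyclesIn_le hG (Finset.mem_univ v)
  have h2 := ncard_cyclesIn_le_cycleBound hG (Fintype.card V - 1) (Finset.univ.erase v)
    (by rw [Finset.card_erase_of_mem (Finset.mem_univ v), Finset.card_univ])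
  have h3 : (Finset.univ.filter (G.Adj v)).card = G.degree v := by
    rw [← card_neighborFinset_eq_degree, neighborFinset_eq_filter]
  rw [h3, Finset.card_univ] at h1
  omega

end

/-! ### Growth of the bounds. -/

/-- The additive 12 absorbs the linear term of the recursion: the step needs `32 * (p + 1) + 12 ≤ 12
* (p + 1) ^ 2`, an equality at `p = 2`, where the base case is an equality too. The constants of
`pathBound_odd` arise in the same way at `p = 1`. -/
theorem pathBound_even (p : ℕ) (hp : 2 ≤ p) :
    32 * pathBound (2 * p) + 12 ≤ 75 * (p.factorial * p.factorial) := by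
  induction p, hp using Nat.le_induction with
  | base => decide
  | succ p hp ih =>
    have e1 : (2 * p + 3) / 2 = p + 1 := by omega
    have e2 : (2 * p + 2) / 2 = p + 1 := by omega
    rw [mul_add, mul_one, pathBound_add_two (by omega), e1, e2, Nat.factorial_succ]
    have h := Nat.mul_le_mul_left ((p + 1) * (p + 1)) ih
    nlinarith

theorem pathBound_odd (p : ℕ) (hp : 1 ≤ p) :
    10 * pathBound (2 * p + 1) + 6 ≤ 23 * ((p + 1).factorial * p.factorial) := by
  induction p, hp using Nat.le_induction with
  | base => decide
  | succ p hp ih =>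
    have e0 : 2 * (p + 1) + 1 = 2 * p + 1 + 2 := by ring
    have e1 : (2 * p + 1 + 3) / 2 = p + 2 := by omega
    have e2 : (2 * p + 1 + 2) / 2 = p + 1 := by omega
    rw [e0, pathBound_add_two (by omega), e1, e2, Nat.factorial_succ (p + 1),
      Nat.factorial_succ p]
    rw [Nat.factorial_succ p] at ih
    have h := Nat.mul_le_mul_left ((p + 1) * (p + 2)) ih
    nlinarith

theorem two_mul_pathBound_le (r : ℕ) (hr : 1 ≤ r) : 2 * pathBound r ≤ pathBound (r + 1) := by
  rcases Nat.lt_or_ge r 5 with h | h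
  · interval_cases r <;> decide
  induction r using Nat.strong_induction_on with
  | _ r ih =>
    obtain ⟨r, rfl⟩ := Nat.exists_eq_add_of_le' h
    have ih' : 2 * pathBound (r + 3) ≤ pathBound (r + 3 + 1) := by
      rcases Nat.lt_or_ge (r + 3) 5 with h' | h'
      · obtain rfl | rfl : r = 0 ∨ r = 1 := by omega
        all_goals decide
      · exact ih (r + 3) (by omega) (by omega) h'
    have h1 : pathBound (r + 5) = (r + 6) / 2 + (r + 5) / 2 * ((r + 6) / 2) * pathBound (r + 3) :=
      pathBound_add_two (by omega)
    have h2 : pathBound (r + 5 + 1) = (r + 7) / 2 + (r + 6) / 2 * ((r + 7) / 2) *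
        pathBound (r + 3 + 1) := pathBound_add_two (r := r + 4) (by omega)
    have e : (r + 7) / 2 = (r + 5) / 2 + 1 := by omega
    rw [h1, h2, e]
    have h3 := one_le_pathBound (r + 3)
    have h4 := Nat.mul_le_mul_left ((r + 6) / 2 * ((r + 5) / 2 + 1)) ih'
    have h5 := Nat.mul_le_mul_left ((r + 6) / 2) h3
    generalize (r + 6) / 2 = a at *
    generalize (r + 5) / 2 = b at *
    linarith

/-- As `pathBound` at least doubles at each step, the sum defining `cycleBound` is dominated
geometrically by its last term. -/
theorem cycleBound_le (n : ℕ) : cycleBound (n + 4) ≤ 2 * (n + 4) ^ 2 * pathBound (n + 1) := by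
  induction n with
  | zero => decide
  | succ n ih =>
    have h1 : cycleBound (n + 1 + 4) = cycleBound (n + 4) + (n + 4) * (n + 3) * pathBound (n + 2) :=
      rfl
    have h2 := Nat.mul_le_mul_left ((n + 4) ^ 2) (two_mul_pathBound_le (n + 1) (by omega))
    rw [h1]
    have h3 : (n + 4) * (n + 3) * pathBound (n + 2) ≤ (n + 4) ^ 2 * pathBound (n + 2) :=
      Nat.mul_le_mul_right _ (by nlinarith)
    have h4 : 2 * (n + 4) ^ 2 * pathBound (n + 2) ≤ 2 * (n + 1 + 4) ^ 2 * pathBound (n + 2) :=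
      Nat.mul_le_mul_right _ (by nlinarith)
    change _ ≤ 2 * (n + 1 + 4) ^ 2 * pathBound (n + 2)
    linarith

/-! ### Lower bounds for the balanced graph. -/

theorem sum_le_cycleCount {V : Type*} [Finite V] (G : SimpleGraph V) (n : ℕ)
    (hn : Nat.card V = n) (s : Finset ℕ) (hs : s ⊆ Finset.Icc 3 n) :
    ∑ m ∈ s, cycleCountOfLength G m ≤ cycleCount G := by
  rw [cycleCount_eq_sum G n hn]
  exact Finset.sum_le_sum_of_subset hs

theorem le_two_mul_cycleCountOfLength {a b k c N : ℕ} (hk : 2 ≤ k)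
    (h : k * N ≤ c * (a.descFactorial k * b.descFactorial k)) :
    N ≤ c * (2 * cycleCountOfLength (completeBipartiteGraph (Fin a) (Fin b)) (2 * k)) := by
  have h1 := Nat.mul_le_mul_left c (descFactorial_mul_le_cycleCountOfLength a b k hk)
  refine Nat.le_of_mul_le_mul_left (h.trans (h1.trans (le_of_eq ?_))) (by omega : 0 < k)
  ring

theorem descFactorial_add_mul (j k : ℕ) :
    j.factorial * (k + j).descFactorial k = (k + j).factorial := by
  have := Nat.factorial_mul_descFactorial (Nat.le_add_right k j)
  rwa [Nat.add_sub_cancel_left] at this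

/-- The lengths `2m` and `2m - 2` each contribute at least half of `m! * (m - 1)!`. -/
theorem le_cycleCount_even (m : ℕ) (hm : 3 ≤ m) :
    2 * (m.factorial * (m - 1).factorial) ≤
      2 * cycleCount (balancedCompleteBipartite (2 * m)) := by
  have e1 : 2 * m / 2 = m := by omega
  have e2 : (2 * m + 1) / 2 = m := by omega
  have hsum := sum_le_cycleCount (balancedCompleteBipartite (2 * m)) (2 * m)
    (card_balanced _) {2 * m, 2 * (m - 1)} (by
      intro x hx
      simp only [Finset.mem_insert, Finset.mem_singleton] at hx
      rw [Finset.mem_Icc]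
      omega)
  rw [Finset.sum_pair (by omega)] at hsum
  unfold balancedCompleteBipartite at *
  rw [e1, e2] at *
  obtain ⟨k, rfl⟩ := Nat.exists_eq_add_of_le' (by omega : 1 ≤ m)
  rw [Nat.add_sub_cancel] at *
  have d0 := Nat.descFactorial_self (k + 1)
  have d1 := descFactorial_add_mul 1 k
  rw [Nat.factorial_one, one_mul] at d1
  have h1 := le_two_mul_cycleCountOfLength (a := k + 1) (b := k + 1) (k := k + 1) (c := 1)
    (N := (k + 1).factorial * k.factorial) (by omega)
    (by rw [d0, Nat.factorial_succ]; nlinarith)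
  have h2 := le_two_mul_cycleCountOfLength (a := k + 1) (b := k + 1) (k := k) (c := 1)
    (N := (k + 1).factorial * k.factorial) (by omega)
    (by
      rw [d1, Nat.factorial_succ]
      have : 0 ≤ (k + 1) * k.factorial * k.factorial := Nat.zero_le _
      nlinarith)
  linarith

/-- Here `19/12 = 1 + 1/2 + 1/12`, from the three longest even lengths. Two lengths would give
`3/2`, which is exactly the leading coefficient of the upper bound in `upper_lt_odd`. -/
theorem le_cycleCount_odd (m : ℕ) (hm : 4 ≤ m) :
    19 * (m.factorial * m.factorial) ≤
      24 * cycleCount (balancedCompleteBipartite (2 * m + 1)) := by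
  have e1 : (2 * m + 1) / 2 = m := by omega
  have e2 : (2 * m + 1 + 1) / 2 = m + 1 := by omega
  have hsum := sum_le_cycleCount (balancedCompleteBipartite (2 * m + 1)) (2 * m + 1)
    (card_balanced _) {2 * m, 2 * (m - 1), 2 * (m - 2)} (by
      intro x hx
      simp only [Finset.mem_insert, Finset.mem_singleton] at hx
      rw [Finset.mem_Icc]
      omega)
  rw [Finset.sum_insert (by simp; omega), Finset.sum_pair (by omega)] at hsum
  unfold balancedCompleteBipartite at *
  rw [e1, e2] at *
  obtain ⟨k, rfl⟩ := Nat.exists_eq_add_of_le' (by omega : 2 ≤ m)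
  rw [Nat.add_sub_cancel, show k + 2 - 1 = k + 1 from rfl] at hsum
  have f3 : (k + 2 + 1).factorial = (k + 3) * (k + 2).factorial := Nat.factorial_succ _
  have d0 := Nat.descFactorial_self (k + 2)
  have d1 := descFactorial_add_mul 1 (k + 1)
  have d2 := descFactorial_add_mul 2 k
  have d0' := descFactorial_add_mul 1 (k + 2)
  have d1' := descFactorial_add_mul 2 (k + 1)
  have d2' := descFactorial_add_mul 3 k
  change 1 * (k + 2).descFactorial (k + 1) = (k + 2).factorial at d1
  change 2 * (k + 2).descFactorial k = (k + 2).factorial at d2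
  change 1 * (k + 2 + 1).descFactorial (k + 2) = (k + 2 + 1).factorial at d0'
  change 2 * (k + 2 + 1).descFactorial (k + 1) = (k + 2 + 1).factorial at d1'
  change 6 * (k + 2 + 1).descFactorial k = (k + 2 + 1).factorial at d2'
  rw [one_mul] at d1 d0'
  generalize (k + 2).factorial = F at *
  have h0 := le_two_mul_cycleCountOfLength (a := k + 2) (b := k + 2 + 1) (k := k + 2) (c := 1)
    (N := F * F) (by omega) (by
      rw [d0, d0', f3]
      nlinarith [Nat.zero_le (F * F)])
  have h1 := le_two_mul_cycleCountOfLength (a := k + 2) (b := k + 2 + 1) (k := k + 1) (c := 2)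
    (N := F * F) (by omega) (by
      rw [d1, mul_left_comm 2 F, d1', f3]
      nlinarith [Nat.zero_le (F * F)])
  have h2 := le_two_mul_cycleCountOfLength (a := k + 2) (b := k + 2 + 1) (k := k) (c := 12)
    (N := F * F) (by omega) (by
      have : 12 * ((k + 2).descFactorial k * (k + 2 + 1).descFactorial k) =
        (2 * (k + 2).descFactorial k) * (6 * (k + 2 + 1).descFactorial k) := by ring
      rw [this, d2, d2', f3]
      nlinarith [Nat.zero_le (F * F)])
  linarith

/-! ### Numerical comparison of upper and lower bounds. -/

theorem upper_lt_even (m d : ℕ) (hm : 100 ≤ m) (hd : 5 * d ≤ 4 * m) :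
    cycleBound (2 * m - 1) + d * (d - 1) * pathBound (2 * m - 3) <
      2 * (m.factorial * (m - 1).factorial) := by
  obtain ⟨k, rfl⟩ := Nat.exists_eq_add_of_le' (by omega : 2 ≤ m)
  have hb := pathBound_even k (by omega)
  have hc := pathBound_odd k (by omega)
  have ht := cycleBound_le (2 * k - 1)
  have e1 : 2 * k - 1 + 4 = 2 * (k + 2) - 1 := by omega
  have e2 : 2 * k - 1 + 1 = 2 * k := by omega
  have e3 : 2 * (k + 2) - 3 = 2 * k + 1 := by omega
  have e4 : k + 2 - 1 = k + 1 := by omega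
  have f1 : (k + 2).factorial = (k + 2) * ((k + 1) * k.factorial) := by
    rw [Nat.factorial_succ, Nat.factorial_succ]
  rw [e1, e2] at ht
  rw [e3, e4, f1]
  rw [Nat.factorial_succ] at *
  have hF : 0 < k.factorial := Nat.factorial_pos k
  have hdd : 25 * (d * (d - 1)) ≤ 16 * ((k + 2) * (k + 1)) := by
    rcases Nat.eq_zero_or_pos d with rfl | hd0
    · simp
    · obtain ⟨d, rfl⟩ := Nat.exists_eq_add_of_le' hd0
      rw [Nat.add_sub_cancel]
      have h1 : 5 * d ≤ 4 * (k + 1) := by omega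
      nlinarith [Nat.mul_le_mul hd h1]
  generalize d * (d - 1) = D at *
  have hP : 0 < k.factorial * k.factorial := Nat.mul_pos hF hF
  have hk' : (2 * (k + 2) - 1) ^ 2 ≤ 4 * (k + 2) ^ 2 := by
    calc (2 * (k + 2) - 1) ^ 2 ≤ (2 * (k + 2)) ^ 2 := Nat.pow_le_pow_left (by omega) 2
      _ = _ := by ring
  generalize hQ : k.factorial * k.factorial = Q at *
  have hc' : 10 * pathBound (2 * k + 1) ≤ 23 * ((k + 1) * Q) := by
    rw [← hQ]
    calc _ ≤ _ := (Nat.le_add_right _ 6).trans hc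
      _ = _ := by ring
  have goalR : 2 * ((k + 2) * ((k + 1) * k.factorial) * ((k + 1) * k.factorial)) =
      2 * ((k + 2) * (k + 1) * (k + 1)) * Q := by rw [← hQ]; ring
  rw [goalR]
  have b1 : 4 * cycleBound (2 * (k + 2) - 1) ≤ 75 * (k + 2) ^ 2 * Q := by
    have h1 : 2 * (2 * (k + 2) - 1) ^ 2 * pathBound (2 * k) ≤
        2 * (4 * (k + 2) ^ 2) * pathBound (2 * k) :=
      Nat.mul_le_mul_right _ (Nat.mul_le_mul_left _ hk')
    have h2 := Nat.mul_le_mul_left ((k + 2) ^ 2) ((Nat.le_add_right _ 12).trans hb)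
    linarith
  have b2 : 250 * (D * pathBound (2 * k + 1)) ≤ 368 * ((k + 2) * (k + 1) * (k + 1)) * Q := by
    have := Nat.mul_le_mul hdd hc'
    linarith
  -- The leading coefficient is `16/25 * 23/10 = 1.472`, and the remaining `2 - 1.472 = 0.528` must
  -- absorb the lower-order `75/4` from `b1`; everything is scaled by 1000.
  have b3 : 18750 * (k + 2) ^ 2 < 528 * ((k + 2) * (k + 1) * (k + 1)) := by
    have : 18750 * (k + 2) < 528 * ((k + 1) * (k + 1)) := by nlinarith
    have := Nat.mul_lt_mul_of_pos_left this (by omega : 0 < k + 2)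
    linarith
  have b4 := Nat.mul_lt_mul_of_pos_right b3 hP
  linarith

theorem upper_lt_odd (m d : ℕ) (hm : 300 ≤ m) (hd : 5 * d ≤ 4 * m + 2) :
    12 * (cycleBound (2 * m) + d * (d - 1) * pathBound (2 * m - 2)) <
      19 * (m.factorial * m.factorial) := by
  obtain ⟨k, rfl⟩ := Nat.exists_eq_add_of_le' (by omega : 2 ≤ m)
  have hb := pathBound_even (k + 1) (by omega)
  have hc := pathBound_odd k (by omega)
  have ht := cycleBound_le (2 * k)
  have e1 : 2 * k + 4 = 2 * (k + 2) := by omega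
  have e3 : 2 * (k + 2) - 2 = 2 * (k + 1) := by omega
  have f1 : (k + 2).factorial = (k + 2) * ((k + 1) * k.factorial) := by
    rw [Nat.factorial_succ, Nat.factorial_succ]
  rw [e1] at ht
  rw [e3, f1]
  rw [Nat.factorial_succ] at *
  have hF : 0 < k.factorial := Nat.factorial_pos k
  have hdd : 25 * (d * (d - 1)) ≤ 16 * (k + 2) ^ 2 := by
    rcases Nat.eq_zero_or_pos d with rfl | hd0
    · simp
    · obtain ⟨d, rfl⟩ := Nat.exists_eq_add_of_le' hd0
      rw [Nat.add_sub_cancel]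
      have h1 : 5 * d ≤ 4 * (k + 2) - 3 := by omega
      obtain ⟨t, ht⟩ : ∃ t, 4 * (k + 2) = t + 3 := ⟨4 * (k + 2) - 3, by omega⟩
      have h2 : 5 * d ≤ t := by omega
      have h3 : 5 * (d + 1) ≤ t + 5 := by omega
      have h4 := Nat.mul_le_mul h3 h2
      have h5 : 16 * (k + 2) ^ 2 = (t + 3) * (t + 3) := by rw [← ht]; ring
      nlinarith
  generalize d * (d - 1) = D at *
  have hP : 0 < k.factorial * k.factorial := Nat.mul_pos hF hF
  generalize hQ : k.factorial * k.factorial = Q at *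
  have hc' : 10 * pathBound (2 * k + 1) ≤ 23 * ((k + 1) * Q) := by
    rw [← hQ]
    calc _ ≤ _ := (Nat.le_add_right _ 6).trans hc
      _ = _ := by ring
  have hb' : 32 * pathBound (2 * (k + 1)) ≤ 75 * ((k + 1) ^ 2 * Q) := by
    rw [← hQ]
    calc _ ≤ _ := (Nat.le_add_right _ 12).trans hb
      _ = _ := by ring
  have goalR : 19 * ((k + 2) * ((k + 1) * k.factorial) * ((k + 2) * ((k + 1) * k.factorial))) =
      19 * ((k + 2) ^ 2 * (k + 1) ^ 2) * Q := by rw [← hQ]; ring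
  rw [goalR]
  have b1 : 10 * cycleBound (2 * (k + 2)) ≤ 184 * ((k + 2) ^ 2 * (k + 1)) * Q := by
    have h2 := Nat.mul_le_mul_left (8 * (k + 2) ^ 2) hc'
    linarith
  have b2 : 2 * (D * pathBound (2 * (k + 1))) ≤ 3 * ((k + 2) ^ 2 * (k + 1) ^ 2) * Q := by
    have := Nat.mul_le_mul hdd hb'
    linarith
  -- The leading coefficient is `16/25 * 75/32 = 3/2`, so `19 - 12 * 3/2 = 1` is left for the `12 *
  -- 18.4` coming from `b1`; everything is scaled by 10.
  have b3 : 2208 * ((k + 2) ^ 2 * (k + 1)) < 10 * ((k + 2) ^ 2 * (k + 1) ^ 2) := by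
    have h0 : 0 < (k + 2) ^ 2 * (k + 1) := by positivity
    have : 2208 < 10 * (k + 1) := by omega
    have := Nat.mul_lt_mul_of_pos_left this h0
    linarith
  have b4 := Nat.mul_lt_mul_of_pos_right b3 hP
  linarith

/-! ### The non-bipartite case and the conclusion. -/

/-- This is the contrapositive of the Andrásfai–Erdős–Sós theorem for triangles, applied to a vertex
of minimum degree. -/
theorem exists_degree_le_of_not_colorable {V : Type*} [Fintype V] {G : SimpleGraph V}
    [DecidableRel G.Adj] (hG : G.CliqueFree 3) (hcol : ¬ G.Colorable 2) :
    ∃ v, 5 * G.degree v ≤ 2 * Fintype.card V := by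
  have h := mt (colorable_of_cliqueFree_lt_minDegree (r := 2) hG) hcol
  have : Nonempty V := by
    by_contra hV
    rw [not_nonempty_iff] at hV
    exact hcol (Colorable.of_isEmpty 2)
  obtain ⟨v, hv⟩ := G.exists_minimal_degree_vertex
  refine ⟨v, ?_⟩
  rw [← hv]
  omega

theorem cycleCount_lt_balanced_of_not_colorable {n : ℕ} (hn : 1000 ≤ n) {V : Type*} [Fintype V]
    (G : SimpleGraph V) (hV : Fintype.card V = n) (hG : G.CliqueFree 3)
    (hcol : ¬ G.Colorable 2) :
    cycleCount G < cycleCount (balancedCompleteBipartite n) := by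
  classical
  obtain ⟨v, hv⟩ := exists_degree_le_of_not_colorable hG hcol
  have h1 : 2 * cycleCount G ≤ cycleBound (Fintype.card V - 1) +
      G.degree v * (G.degree v - 1) * pathBound (Fintype.card V - 3) := by
    convert two_mul_cycleCount_le hG v
  rw [hV] at hv h1
  obtain ⟨m, rfl | rfl⟩ := Nat.even_or_odd' n
  · have h2 := upper_lt_even m (G.degree v) (by omega) (by omega)
    have h3 := le_cycleCount_even m (by omega)
    omega
  · have h2 := upper_lt_odd m (G.degree v) (by omega) (by omega)
    have h3 := le_cycleCount_odd m (by omega)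
    have e1 : 2 * m + 1 - 1 = 2 * m := by omega
    have e2 : 2 * m + 1 - 3 = 2 * m - 2 := by omega
    rw [e1, e2] at h1
    omega

theorem theorem5p1 :
    ∃ n₀ : ℕ, 0 < n₀ ∧ ∀ n : ℕ, n₀ ≤ n →
      (balancedCompleteBipartite n).CliqueFree 3 ∧
      ∀ (V : Type*) [Fintype V] (G : SimpleGraph V),
        Fintype.card V = n → G.CliqueFree 3 →
        ¬ Nonempty (G ≃g balancedCompleteBipartite n) →
        cycleCount G < cycleCount (balancedCompleteBipartite n) := by
  refine ⟨1000, by norm_num, fun n hn => ⟨?_, ?_⟩⟩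
  · have h : (balancedCompleteBipartite n).Colorable 2 := by
      simpa using (sideColoring (Fin (n / 2)) (Fin ((n + 1) / 2))).colorable
    exact h.cliqueFree (by norm_num)
  · intro V _ G hV hG hiso
    by_cases hcol : G.Colorable 2
    · exact cycleCount_lt_balanced_of_coloring (by omega) G hV (hcol.toColoring (by simp)) hiso
    · exact cycleCount_lt_balanced_of_not_colorable hn G hV hG hcol
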